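/- For integers $d_0,q\ge 1$ write $x=(x_1,\dots,x_{d_0})\in(\mathbb R^q)^{d_0}=\mathbb R^d$, $d=d_0q$, let $|\cdot|$ be the Euclidean norm, and consider the mean-field potential $$U(x)=\sum_{i=1}^{d_0}U^{(q)}(x_i)+\frac{\epsilon}{d_0}\sum_{i,j=1}^{d_0}W^{(q)}(x_i-x_j),\qquad \epsilon>0.$$ Assumption H4, with constants $L_U,L_W\ge 0$, $\mathfrak m>0$, $\mathfrak M\ge0$: $U^{(q)},W^{(q)}\in C^2(\mathbb R^q)$, $\sup_x|\nabla^2U^{(q)}(x)|\le L_U$ and $\sup_x|\nabla^2W^{(q)}(x)|\le L_W$ in operator norm, $\nabla U^{(q)}(0)=\nabla W^{(q)}(0)=0$, and $\langle y,\nabla U^{(q)}(y)\rangle\ge\mathfrak m|y|^2-\mathfrak M$ for all $y\in\mathbb R^q$. For $\delta>0$ let $\Phi_\delta=\Phi^{(v)}_{\delta/2}\circ\Phi^{(x)}_\delta\circ\Phi^{(v)}_{\delta/2}$ be the Verlet step, with $\Phi^{(v)}_{\delta/2}(x,v)=(x,v-\frac\delta2\nabla U(x))$ and $\Phi^{(x)}_\delta(x,v)=(x+\delta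 v,v)$, and put $V_\delta f=f\circ\Phi_\delta$. For $\eta\in[0,1)$ put $D_\eta f(x,v)=\mathbb E\big[f(x,\eta v+\sqrt{1-\eta^2}\,G)\big]$ with $G$ a standard Gaussian vector of $\mathbb R^d$, and for $\omega=(K,\delta,\eta)$ put $P_\omega=D_\eta V_\delta^K$. Let $$\mathfrak W(x,v)=\sum_{\ell\in\{2,4,6\}}\sum_{i=1}^{d_0}\big(|x_i|^\ell+|v_i|^\ell\big).$$ Theorem. For all $L_U,L_W\ge0$, $\mathfrak m>0$, $\mathfrak M\ge0$ and $\gamma_0>0$ there are $\bar T,\bar\delta,\bar C_1,\bar C_2,\bar\epsilon,\rho>0$, depending only on these five numbers (in particular not on $q$ or $d_0$), such that the following holds for all $d_0,q\ge1$ and all $U^{(q)},W^{(q)}$ satisfying H4 with the constants $L_U,L_W,\mathfrak m,\mathfrak M$. For every $\epsilon\in(0,\bar\epsilon]$, every integer $K\ge1$, $\delta\in(0,\bar\delta]$ and $\eta\in[0,1)$ with $(1-\eta)/(K\delta)=\gamma_0$ and $K\delta\le\bar T$, every $(x,v)\in\mathbb R^{2d}$, $k\in\{0,\dots,K\}$ and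 $n\in\mathbb N$ (including $n=0$), $$P_\omega^nD_\eta V_\delta^k\mathfrak W(x,v)\le\bar C_1e^{-\rho nK\delta}\,\mathfrak W(x,v)+\bar C_2\,d_0q^3.$$ -/

import Mathlib

open MeasureTheory ProbabilityTheory
open scoped ENNReal Gradient InnerProductSpace ContDiff

noncomputable section

namespace GHMC

section Dynamics

variable {E : Type*} [NormedAddCommGroup E] [InnerProductSpace ℝ E] [FiniteDimensional ℝ E]
  [MeasurableSpace E] [BorelSpace E]

/-- The half-step velocity kick `(x, v) ↦ (x, v - (δ/2) ∇U(x))`. -/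
def kick (U : E → ℝ) (δ : ℝ) (z : E × E) : E × E :=
  (z.1, z.2 - (δ / 2) • ∇ U z.1)

/-- The free transport step `(x, v) ↦ (x + δ v, v)`. -/
def transport (δ : ℝ) (z : E × E) : E × E :=
  (z.1 + δ • z.2, z.2)

/-- One Verlet (leapfrog) step `Φ_δ` for the potential `U`. -/
def verlet (U : E → ℝ) (δ : ℝ) (z : E × E) : E × E :=
  kick U δ (transport δ (kick U δ z))

/-- The deterministic Markov operator `V_δ f = f ∘ Φ_δ` on nonnegative functions. -/
def verletOp (U : E → ℝ) (δ : ℝ) (f : E × E → ℝ≥0∞) : E × E → ℝ≥0∞ :=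
  fun z => f (verlet U δ z)

/-- The velocity refreshment operator
`D_η f (x, v) = 𝔼[f (x, η v + √(1 - η²) G)]`, `G` standard Gaussian, on nonnegative functions. -/
def refreshOp (η : ℝ) (f : E × E → ℝ≥0∞) : E × E → ℝ≥0∞ :=
  fun z => ∫⁻ g, f (z.1, η • z.2 + Real.sqrt (1 - η ^ 2) • g) ∂(stdGaussian E)

/-- The Markov operator `P_ω = D_η V_δ^K` of generalized Hamiltonian Monte Carlo,
with parameters `ω = (K, δ, η)`, on nonnegative functions. -/
def ghmcOp (U : E → ℝ) (K : ℕ) (δ η : ℝ) (f : E × E → ℝ≥0∞) : E × E → ℝ≥0∞ :=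
  refreshOp η ((verletOp U δ)^[K] f)

end Dynamics

/-- The position space `ℝ^d = (ℝ^q)^{d₀}` with its Euclidean structure;
`x i` is the `i`-th block of `x`, a vector of `ℝ^q`. -/
abbrev BlockSpace (d₀ q : ℕ) : Type :=
  PiLp 2 (fun _ : Fin d₀ => EuclideanSpace ℝ (Fin q))

/-- The mean-field potential
`U(x) = ∑ i, U^{(q)}(x_i) + (ε / d₀) ∑ i j, W^{(q)}(x_i - x_j)`. -/
def meanFieldPotential {q : ℕ} (d₀ : ℕ) (Uq Wq : EuclideanSpace ℝ (Fin q) → ℝ) (ε : ℝ)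
    (x : BlockSpace d₀ q) : ℝ :=
  ∑ i, Uq (x i) + ε / (d₀ : ℝ) * ∑ i, ∑ j, Wq (x i - x j)

/-- The Hessian `∇²f(x)`, as a linear operator, is the derivative of the gradient. -/
def hessian {q : ℕ} (f : EuclideanSpace ℝ (Fin q) → ℝ) (x : EuclideanSpace ℝ (Fin q)) :
    EuclideanSpace ℝ (Fin q) →L[ℝ] EuclideanSpace ℝ (Fin q) :=
  fderiv ℝ (∇ f) x

/-- The assumptions on the one-block potentials: `C²`, Hessians bounded in operator norm by
`LU` and `LW`, gradients vanishing at the origin, and the drift condition with constants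
`m`, `M`. -/
structure PotentialAssumption {q : ℕ} (Uq Wq : EuclideanSpace ℝ (Fin q) → ℝ)
    (LU LW m M : ℝ) : Prop where
  contDiff_U : ContDiff ℝ 2 Uq
  contDiff_W : ContDiff ℝ 2 Wq
  hessian_U_le : ∀ x, ‖hessian Uq x‖ ≤ LU
  hessian_W_le : ∀ x, ‖hessian Wq x‖ ≤ LW
  gradient_U_zero : ∇ Uq 0 = 0
  gradient_W_zero : ∇ Wq 0 = 0
  drift_U : ∀ x, m * ‖x‖ ^ 2 - M ≤ ⟪x, ∇ Uq x⟫_ℝ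

/-- The function `𝔚(x, v) = ∑_{ℓ ∈ {2,4,6}} ∑ i, (|x_i|^ℓ + |v_i|^ℓ)`. -/
def lyapunov {d₀ q : ℕ} (z : BlockSpace d₀ q × BlockSpace d₀ q) : ℝ :=
  ∑ l ∈ ({2, 4, 6} : Finset ℕ), ∑ i, (‖z.1 i‖ ^ l + ‖z.2 i‖ ^ l)

end GHMC

end

/-!
Write `T = K δ` and `γ = γ₀`, so that `η = 1 - γ T`. For small `T` and `ε` the algorithm is a
perturbation of `d₀` independent Langevin dynamics with friction `γ`. For these, the modified
energy of one block,

  `R = U(x) - U(0) + |v|² / 2 + (γ / 2) ⟪x, v⟫ + (γ² / 4) |x|² + c`,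

has time derivative `-(γ / 2) (|v|² + ⟪x, ∇U(x)⟫)` plus noise, and the drift condition makes `R`
comparable to `|x|² + |v|²` up to constants. The Lyapunov function of the proof is `F = ∑ i, R_i³`
(`cubicEnergy`), which is comparable to `𝔚` up to a multiple of `d₀`.

The argument has the following ingredients, all with constants that do not depend on the
dimensions.

* The force on a block is the one-block force up to `2 L_W ε (|x_i| + mean |x_j|)`
  (`nearlyDecoupled_gradient`). Hence `K` Verlet steps amount, in each block, to one explicit
  Euler step of length `T` for the decoupled dynamics, up to an error `O(T (T + ε))` relative to
  the size of the block plus the mean size (`norm_verlet_iterate_sub_euler_le`).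
* Expanding `R` along this Euler step (`energy_euler_le`) and along the velocity refreshment
  (`energy_refresh_le`), the energy after one step with noise `g` is at most `(1 - c₁ T) R ± S`
  plus `O(T (T + ε))` times energies plus `O(T)` times squares of the noise, where `S` is linear
  in `g` and `S² = O(T) R |g|²` (`exists_blockEnergy_step`).
* The Gaussian law is invariant under `g ↦ -g`, so that the cube of the energy may be averaged
  over `±g` before it is integrated; then `S` enters through `S² = O(T)` only, and Young's
  inequality gives a contraction of `F` by `1 - ρ T`, pointwise in `g`, up to `O(T)` times sixth
  powers of the noise (`exists_cube_contraction`, `exists_cubicEnergy_step`). The mean-field terms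
  are absorbed after summation over the blocks, by convexity of the cube.
* The sixth moment of a block of the noise is at most a constant times `q³`
  (`lintegral_norm_block_pow_six_le`). This gives the drift inequality
  `P F ≤ (1 - ρ T) F + O(T d₀ q³)` (`exists_ghmcOp_cubicEnergy_le`), which is iterated in
  `iterate_ghmcOp_le`.

The operator `D_η V_δ^k` with `k ≤ K` is handled by a crude Grönwall bound
(`exists_refreshOp_verletOp_lyapunov_le`).
-/

namespace GHMC

/-! ### A one-block potential -/

section Potential

variable {E : Type*} [NormedAddCommGroup E] [InnerProductSpace ℝ E] [CompleteSpace E]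
  {U : E → ℝ} {L : ℝ}

theorem differentiable_gradient (hU : ContDiff ℝ 2 U) : Differentiable ℝ (∇ U) := by
  have h : ContDiff ℝ 1 (fderiv ℝ U) := hU.fderiv_right (by norm_num)
  exact (InnerProductSpace.toDual ℝ E).symm.differentiable.comp (h.differentiable (by norm_num))

theorem norm_gradient_sub_le (hU : ContDiff ℝ 2 U) (hL : ∀ x, ‖fderiv ℝ (∇ U) x‖ ≤ L) (x y : E) :
    ‖∇ U y - ∇ U x‖ ≤ L * ‖y - x‖ :=
  convex_univ.norm_image_sub_le_of_norm_fderiv_le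
    (fun x _ => differentiable_gradient hU x) (fun x _ => hL x) (Set.mem_univ x) (Set.mem_univ y)

theorem norm_gradient_le (hU : ContDiff ℝ 2 U) (hL : ∀ x, ‖fderiv ℝ (∇ U) x‖ ≤ L)
    (h0 : ∇ U 0 = 0) (x : E) : ‖∇ U x‖ ≤ L * ‖x‖ := by
  simpa [h0] using norm_gradient_sub_le hU hL 0 x

/-- First-order Taylor estimate; the constant `L` in place of `L / 2` is enough here. -/
theorem abs_sub_sub_inner_gradient_le (hU : ContDiff ℝ 2 U)
    (hL : ∀ x, ‖fderiv ℝ (∇ U) x‖ ≤ L) (x y : E) :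
    |U y - U x - ⟪∇ U x, y - x⟫_ℝ| ≤ L * ‖y - x‖ ^ 2 := by
  have hL0 : 0 ≤ L := (norm_nonneg _).trans (hL 0)
  have hd : Differentiable ℝ U := hU.differentiable (by norm_num)
  have h := (convex_closedBall x ‖y - x‖).norm_image_sub_le_of_norm_fderiv_le'
    (f := U) (φ := fderiv ℝ U x) (C := L * ‖y - x‖) (x := x) (y := y) (𝕜 := ℝ)
    (fun z _ => hd z) (fun z hz => by
      rw [← toDual_gradient, ← toDual_gradient, ← map_sub, LinearIsometryEquiv.norm_map]
      refine (norm_gradient_sub_le hU hL x z).trans ?_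
      gcongr
      simpa [dist_eq_norm] using hz)
    (by simp) (by simp [dist_eq_norm])
  rw [← inner_gradient_left] at h
  rw [Real.norm_eq_abs] at h
  linarith [h, sq (‖y - x‖)]

theorem abs_sub_le_of_gradient_zero (hU : ContDiff ℝ 2 U) (hL : ∀ x, ‖fderiv ℝ (∇ U) x‖ ≤ L)
    (h0 : ∇ U 0 = 0) (x : E) : |U x - U 0| ≤ L * ‖x‖ ^ 2 := by
  simpa [h0] using abs_sub_sub_inner_gradient_le hU hL 0 x

/-- A potential satisfying the drift condition is bounded below: it is at least
`U 0 - L M / m` on the ball of radius `√(M / m)` by Taylor's estimate, and outside of this ball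
it is nondecreasing along rays. -/
theorem le_sub_of_drift {m M : ℝ} (hm : 0 < m) (hM : 0 ≤ M) (hU : ContDiff ℝ 2 U)
    (hL : ∀ x, ‖fderiv ℝ (∇ U) x‖ ≤ L) (h0 : ∇ U 0 = 0)
    (hdrift : ∀ x, m * ‖x‖ ^ 2 - M ≤ ⟪x, ∇ U x⟫_ℝ) (x : E) :
    -(L * (M / m)) ≤ U x - U 0 := by
  have hL0 : 0 ≤ L := (norm_nonneg _).trans (hL 0)
  have hd : Differentiable ℝ U := hU.differentiable (by norm_num)
  have ball : ∀ y : E, ‖y‖ ^ 2 ≤ M / m → -(L * (M / m)) ≤ U y - U 0 := fun y hy => by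
    have := (abs_le.1 (abs_sub_le_of_gradient_zero hU hL h0 y)).1
    nlinarith
  by_cases hx : ‖x‖ ^ 2 ≤ M / m
  · exact ball x hx
  push Not at hx
  have hMm : 0 ≤ M / m := by positivity
  have hx0 : 0 < ‖x‖ := by
    by_contra h
    have : ‖x‖ = 0 := le_antisymm (not_lt.1 h) (norm_nonneg _)
    rw [this] at hx; norm_num at hx; linarith
  set t₀ : ℝ := Real.sqrt (M / m) / ‖x‖ with ht₀
  have ht₀0 : 0 ≤ t₀ := by positivity
  have ht₀x : (t₀ * ‖x‖) ^ 2 = M / m := by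
    rw [ht₀, div_mul_cancel₀ _ hx0.ne', Real.sq_sqrt hMm]
  have ht₀1 : t₀ ≤ 1 := by
    rw [ht₀, div_le_one hx0]
    exact (Real.sqrt_le_left hx0.le).2 hx.le
  have hder : ∀ t : ℝ, HasDerivAt (fun t : ℝ => U (t • x)) ⟪∇ U (t • x), x⟫_ℝ t := fun t => by
    have h1 : HasDerivAt (fun t : ℝ => t • x) x t := by
      simpa using (hasDerivAt_id t).smul_const x
    have h2 := (hd (t • x)).hasFDerivAt.comp_hasDerivAt t h1
    rwa [← inner_gradient_left] at h2
  have hmono : MonotoneOn (fun t : ℝ => U (t • x)) (Set.Icc t₀ 1) := by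
    refine monotoneOn_of_deriv_nonneg (convex_Icc _ _)
      (fun t _ => (hder t).continuousAt.continuousWithinAt)
      (fun t _ => (hder t).differentiableAt.differentiableWithinAt) fun t ht => ?_
    rw [interior_Icc] at ht
    have htpos : 0 < t := ht₀0.trans_lt ht.1
    rw [(hder t).deriv]
    have h1 := hdrift (t • x)
    rw [norm_smul, Real.norm_of_nonneg htpos.le, real_inner_smul_left, real_inner_comm] at h1
    have h2 : M / m ≤ (t * ‖x‖) ^ 2 := by
      rw [← ht₀x]; gcongr; exact ht.1.le
    rw [div_le_iff₀ hm] at h2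
    have h3 : 0 ≤ t * ⟪∇ U (t • x), x⟫_ℝ := by linarith
    exact nonneg_of_mul_nonneg_right h3 htpos
  have h1 := hmono ⟨le_rfl, ht₀1⟩ ⟨ht₀1, le_rfl⟩ ht₀1
  have h2 := ball (t₀ • x) (by
    rw [norm_smul, Real.norm_of_nonneg ht₀0, ht₀x])
  simp only [one_smul] at h1
  linarith

end Potential

/-! ### The mean-field force -/

section MeanField

variable {d₀ q : ℕ}

/-- The average of a real quantity over the `d₀` blocks (`0` when `d₀ = 0`). -/
noncomputable def blockMean (f : Fin d₀ → ℝ) : ℝ := (∑ j, f j) / d₀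

theorem blockMean_mono {f g : Fin d₀ → ℝ} (h : ∀ j, f j ≤ g j) : blockMean f ≤ blockMean g := by
  unfold blockMean
  gcongr
  exact h _

theorem blockMean_nonneg {f : Fin d₀ → ℝ} (h : ∀ j, 0 ≤ f j) : 0 ≤ blockMean f :=
  div_nonneg (Finset.sum_nonneg fun j _ => h j) (Nat.cast_nonneg _)

theorem blockMean_add (f g : Fin d₀ → ℝ) :
    blockMean (fun j => f j + g j) = blockMean f + blockMean g := by
  simp [blockMean, Finset.sum_add_distrib, add_div]

theorem blockMean_const_mul (c : ℝ) (f : Fin d₀ → ℝ) :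
    blockMean (fun j => c * f j) = c * blockMean f := by
  simp [blockMean, ← Finset.mul_sum, mul_div_assoc]

theorem blockMean_const [NeZero d₀] (c : ℝ) : blockMean (fun _ : Fin d₀ => c) = c := by
  have : (d₀ : ℝ) ≠ 0 := Nat.cast_ne_zero.2 (NeZero.ne d₀)
  simp [blockMean, this]

theorem card_mul_blockMean [NeZero d₀] (f : Fin d₀ → ℝ) : d₀ * blockMean f = ∑ i, f i :=
  mul_div_cancel₀ _ (Nat.cast_ne_zero.2 (NeZero.ne d₀))

theorem blockMean_pow_le [NeZero d₀] {f : Fin d₀ → ℝ} (h : ∀ j, 0 ≤ f j) (n : ℕ) :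
    blockMean f ^ n ≤ blockMean fun j => f j ^ n := by
  have hd : (d₀ : ℝ) ≠ 0 := Nat.cast_ne_zero.2 (NeZero.ne d₀)
  have := Real.pow_arith_mean_le_arith_mean_pow Finset.univ (fun _ : Fin d₀ => (d₀ : ℝ)⁻¹) f
    (fun _ _ => by positivity) (by simp [hd]) (fun j _ => h j) n
  simpa [blockMean, ← Finset.mul_sum, div_eq_inv_mul] using this

theorem gradient_meanFieldPotential {Uq Wq : EuclideanSpace ℝ (Fin q) → ℝ}
    (hU : Differentiable ℝ Uq) (hW : Differentiable ℝ Wq) (ε : ℝ) (x : BlockSpace d₀ q) :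
    ∇ (meanFieldPotential d₀ Uq Wq ε) x = WithLp.toLp 2 fun i =>
      ∇ Uq (x i) + (ε / d₀) • ∑ j, (∇ Wq (x i - x j) - ∇ Wq (x j - x i)) := by
  have hp : ∀ i, HasFDerivAt (fun x : BlockSpace d₀ q => x i)
      (PiLp.proj 2 (fun _ : Fin d₀ => EuclideanSpace ℝ (Fin q)) i : _ →L[ℝ] _) x := fun i =>
    (PiLp.proj 2 (fun _ : Fin d₀ => EuclideanSpace ℝ (Fin q)) i : _ →L[ℝ] _).hasFDerivAt
  have h1 : ∀ i, HasFDerivAt (fun x : BlockSpace d₀ q => Uq (x i))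
      ((fderiv ℝ Uq (x i)).comp (PiLp.proj 2 (fun _ : Fin d₀ => EuclideanSpace ℝ (Fin q)) i)) x :=
    fun i => (hU (x i)).hasFDerivAt.comp x (hp i)
  have h2 : ∀ i j, HasFDerivAt (fun x : BlockSpace d₀ q => Wq (x i - x j))
      ((fderiv ℝ Wq (x i - x j)).comp
        (PiLp.proj 2 (fun _ : Fin d₀ => EuclideanSpace ℝ (Fin q)) i -
          PiLp.proj 2 (fun _ : Fin d₀ => EuclideanSpace ℝ (Fin q)) j)) x :=
    fun i j => (hW (x i - x j)).hasFDerivAt.comp x ((hp i).sub (hp j))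
  have h3 := (HasFDerivAt.fun_sum (u := Finset.univ) fun i _ => h1 i).add
    ((HasFDerivAt.fun_sum (u := Finset.univ) fun i _ =>
      HasFDerivAt.fun_sum (u := Finset.univ) fun j _ => h2 i j).const_mul (ε / d₀))
  refine HasGradientAt.gradient (hasGradientAt_iff_hasFDerivAt.2 ?_)
  refine h3.congr_fderiv ?_
  ext h
  rw [InnerProductSpace.toDual_apply_apply, PiLp.inner_apply]
  simp only [add_apply, sum_apply, smul_apply, sub_apply,
    ContinuousLinearMap.comp_apply, PiLp.proj_apply, inner_add_left,
    real_inner_smul_left, sum_inner, inner_sub_left, inner_gradient_left, Finset.sum_add_distrib,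
    map_sub, Finset.sum_sub_distrib, ← Finset.mul_sum, smul_eq_mul]
  rw [Finset.sum_comm (f := fun i j => (fderiv ℝ Wq (x i - x j)) (h j))]

/-- A block force field `F` which differs from the one-block force `g` by an interaction of
strength at most `κ`, measured against the size of the block plus the average size. The one-block
force is Lipschitz and vanishes at the origin. -/
structure NearlyDecoupled (F : BlockSpace d₀ q → BlockSpace d₀ q)
    (g : EuclideanSpace ℝ (Fin q) → EuclideanSpace ℝ (Fin q)) (L κ : ℝ) : Prop where
  lipschitz : ∀ x y, ‖g y - g x‖ ≤ L * ‖y - x‖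
  zero : g 0 = 0
  near : ∀ x i, ‖F x i - g (x i)‖ ≤ κ * (‖x i‖ + blockMean fun j => ‖x j‖)

theorem nearlyDecoupled_gradient {Uq Wq : EuclideanSpace ℝ (Fin q) → ℝ} {LU LW m M ε : ℝ}
    (h : PotentialAssumption Uq Wq LU LW m M) (hε : 0 ≤ ε) :
    NearlyDecoupled (∇ (meanFieldPotential d₀ Uq Wq ε)) (∇ Uq) LU (2 * LW * ε) where
  lipschitz := norm_gradient_sub_le h.contDiff_U h.hessian_U_le
  zero := h.gradient_U_zero
  near x i := by
    have : NeZero d₀ := ⟨fun h => by subst h; exact i.elim0⟩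
    have hLW : 0 ≤ LW := (norm_nonneg _).trans (h.hessian_W_le 0)
    have hW := norm_gradient_le h.contDiff_W h.hessian_W_le h.gradient_W_zero
    rw [gradient_meanFieldPotential (h.contDiff_U.differentiable (by norm_num))
      (h.contDiff_W.differentiable (by norm_num))]
    simp only [add_sub_cancel_left]
    rw [norm_smul, Real.norm_of_nonneg (by positivity)]
    calc ε / d₀ * ‖∑ j, (∇ Wq (x i - x j) - ∇ Wq (x j - x i))‖
        ≤ ε / d₀ * ∑ j, 2 * LW * (‖x i‖ + ‖x j‖) := by
          gcongr
          refine (norm_sum_le _ _).trans (Finset.sum_le_sum fun j _ => ?_)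
          have h1 := norm_sub_le (x i) (x j)
          have h2 := norm_sub_le (∇ Wq (x i - x j)) (∇ Wq (x j - x i))
          have h3 := hW (x i - x j)
          have h4 := hW (x j - x i)
          rw [norm_sub_rev (x j)] at h4
          nlinarith
      _ = ε * blockMean fun j => 2 * LW * (‖x i‖ + ‖x j‖) := by
          rw [blockMean]; ring
      _ = _ := by
          rw [blockMean_const_mul, blockMean_add, blockMean_const]; ring

end MeanField

/-! ### Verlet trajectories -/

section Verlet

variable {d₀ q : ℕ}

/-- The size `|x_i| + |v_i|` of the `i`-th block of a phase space point. -/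
noncomputable def blockNorm (z : BlockSpace d₀ q × BlockSpace d₀ q) (i : Fin d₀) : ℝ :=
  ‖z.1 i‖ + ‖z.2 i‖

/-- The size of the `i`-th block plus the average size of a block; it controls the force on the
`i`-th block. -/
noncomputable def totalNorm (z : BlockSpace d₀ q × BlockSpace d₀ q) (i : Fin d₀) : ℝ :=
  blockNorm z i + blockMean (blockNorm z)

theorem blockNorm_nonneg (z : BlockSpace d₀ q × BlockSpace d₀ q) (i : Fin d₀) :
    0 ≤ blockNorm z i := by unfold blockNorm; positivity

theorem blockNorm_le_totalNorm (z : BlockSpace d₀ q × BlockSpace d₀ q) (i : Fin d₀) :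
    blockNorm z i ≤ totalNorm z i :=
  le_add_of_nonneg_right (blockMean_nonneg (blockNorm_nonneg z))

theorem totalNorm_nonneg (z : BlockSpace d₀ q × BlockSpace d₀ q) (i : Fin d₀) :
    0 ≤ totalNorm z i := (blockNorm_nonneg z i).trans (blockNorm_le_totalNorm z i)

theorem blockMean_totalNorm (z : BlockSpace d₀ q × BlockSpace d₀ q) (i : Fin d₀) :
    blockMean (totalNorm z) ≤ 2 * totalNorm z i := by
  have : NeZero d₀ := ⟨fun h => by subst h; exact i.elim0⟩
  have h : blockMean (totalNorm z) = blockMean (blockNorm z) + blockMean (blockNorm z) := by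
    unfold totalNorm
    rw [blockMean_add, blockMean_const]
  have := blockNorm_nonneg z i
  rw [h, totalNorm]; linarith

variable {U : BlockSpace d₀ q → ℝ} {g : EuclideanSpace ℝ (Fin q) → EuclideanSpace ℝ (Fin q)}
  {L κ Λ δ T : ℝ}

theorem NearlyDecoupled.norm_sub_le {F : BlockSpace d₀ q → BlockSpace d₀ q}
    (h : NearlyDecoupled F g L κ) (hκ : 0 ≤ κ) (z : BlockSpace d₀ q × BlockSpace d₀ q)
    (i : Fin d₀) : ‖F z.1 i - g (z.1 i)‖ ≤ κ * totalNorm z i := by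
  refine (h.near z.1 i).trans ?_
  unfold totalNorm
  gcongr
  · exact le_add_of_nonneg_right (norm_nonneg _)
  · exact blockMean_mono fun j => le_add_of_nonneg_right (norm_nonneg _)

theorem NearlyDecoupled.norm_le {F : BlockSpace d₀ q → BlockSpace d₀ q}
    (h : NearlyDecoupled F g L κ) (hL : 0 ≤ L) (hΛ : L + κ ≤ Λ)
    (x : BlockSpace d₀ q) (i : Fin d₀) :
    ‖F x i‖ ≤ Λ * (‖x i‖ + blockMean fun j => ‖x j‖) := by
  have h1 := h.near x i
  have h2 : ‖g (x i)‖ ≤ L * ‖x i‖ := by simpa [h.zero] using h.lipschitz 0 (x i)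
  have h3 : ‖F x i‖ ≤ ‖F x i - g (x i)‖ + ‖g (x i)‖ := norm_le_norm_sub_add _ _
  have h4 : 0 ≤ blockMean fun j => ‖x j‖ := blockMean_nonneg fun j => norm_nonneg _
  have h5 := norm_nonneg (x i)
  nlinarith

theorem verlet_fst (z : BlockSpace d₀ q × BlockSpace d₀ q) (i : Fin d₀) :
    (verlet U δ z).1 i = z.1 i + δ • (z.2 i - (δ / 2) • ∇ U z.1 i) := by
  simp [verlet, kick, transport]

theorem verlet_snd (z : BlockSpace d₀ q × BlockSpace d₀ q) (i : Fin d₀) :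
    (verlet U δ z).2 i =
      z.2 i - (δ / 2) • ∇ U z.1 i - (δ / 2) • ∇ U (verlet U δ z).1 i := by
  simp [verlet, kick, transport]

/-- A single Verlet step moves the `i`-th block by `O(δ)` relative to its size and the average
size of a block. -/
theorem norm_verlet_sub_le (h : NearlyDecoupled (∇ U) g L κ) (hL : 0 ≤ L) (hκ : 0 ≤ κ)
    (hΛ : L + κ ≤ Λ) (hΛ1 : 1 ≤ Λ) (hδ : 0 ≤ δ) (hδ1 : δ ≤ 1)
    (z : BlockSpace d₀ q × BlockSpace d₀ q) (i : Fin d₀) :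
    ‖(verlet U δ z).1 i - z.1 i‖ ≤ 2 * Λ * δ * totalNorm z i ∧
      ‖(verlet U δ z).2 i - z.2 i‖ ≤ 4 * Λ ^ 2 * δ * totalNorm z i := by
  have hF : ∀ i, ‖∇ U z.1 i‖ ≤ Λ * totalNorm z i := fun i => by
    refine (h.norm_le hL hΛ z.1 i).trans ?_
    unfold totalNorm
    gcongr
    · exact le_add_of_nonneg_right (norm_nonneg _)
    · exact blockMean_mono fun j => le_add_of_nonneg_right (norm_nonneg _)
  have hx : ∀ i, ‖(verlet U δ z).1 i - z.1 i‖ ≤ 2 * Λ * δ * totalNorm z i := fun i => by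
    rw [verlet_fst, add_sub_cancel_left, norm_smul, Real.norm_of_nonneg hδ]
    have h1 : ‖z.2 i - (δ / 2) • ∇ U z.1 i‖ ≤ ‖z.2 i‖ + δ / 2 * ‖∇ U z.1 i‖ := by
      refine (norm_sub_le _ _).trans_eq ?_
      rw [norm_smul, Real.norm_of_nonneg (by positivity)]
    have h2 : ‖z.2 i‖ ≤ totalNorm z i :=
      (le_add_of_nonneg_left (norm_nonneg _)).trans (blockNorm_le_totalNorm z i)
    have h3 : δ / 2 * ‖∇ U z.1 i‖ ≤ 1 * (Λ * totalNorm z i) := by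
      gcongr
      · linarith
      · exact hF i
    have h4 : totalNorm z i ≤ Λ * totalNorm z i :=
      le_mul_of_one_le_left (totalNorm_nonneg z i) hΛ1
    calc δ * ‖z.2 i - (δ / 2) • ∇ U z.1 i‖ ≤ δ * (2 * Λ * totalNorm z i) := by
          gcongr; linarith
      _ = _ := by ring
  refine ⟨hx i, ?_⟩
  have hs := totalNorm_nonneg z i
  have hF' : ‖∇ U (verlet U δ z).1 i‖ ≤ 7 * Λ ^ 2 * totalNorm z i := by
    have h0 := h.norm_le hL hΛ (verlet U δ z).1 i
    have h1 : ∀ j, ‖(verlet U δ z).1 j‖ ≤ blockNorm z j + 2 * Λ * totalNorm z j := fun j => by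
      have h1 : ‖(verlet U δ z).1 j‖ ≤ ‖(verlet U δ z).1 j - z.1 j‖ + ‖z.1 j‖ :=
        norm_le_norm_sub_add _ _
      have h2 : 2 * Λ * δ * totalNorm z j ≤ 2 * Λ * 1 * totalNorm z j := by
        have := totalNorm_nonneg z j
        gcongr
      have h3 : ‖z.1 j‖ ≤ blockNorm z j := le_add_of_nonneg_right (norm_nonneg _)
      linarith [hx j]
    have h2 : blockMean (fun j => ‖(verlet U δ z).1 j‖) ≤
        blockMean (blockNorm z) + 2 * Λ * blockMean (totalNorm z) := by
      rw [← blockMean_const_mul, ← blockMean_add]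
      exact blockMean_mono h1
    have h3 := blockMean_totalNorm z i
    have h4 : ‖(verlet U δ z).1 i‖ + blockMean (fun j => ‖(verlet U δ z).1 j‖) ≤
        7 * Λ * totalNorm z i := by
      have h5 := h1 i
      have h6 : totalNorm z i = blockNorm z i + blockMean (blockNorm z) := rfl
      nlinarith
    calc _ ≤ Λ * (7 * Λ * totalNorm z i) := h0.trans (by gcongr)
      _ = _ := by ring
  have h1 : (verlet U δ z).2 i - z.2 i =
      -((δ / 2) • (∇ U z.1 i + ∇ U (verlet U δ z).1 i)) := by
    rw [verlet_snd, smul_add]; abel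
  have h2 : ‖∇ U z.1 i + ∇ U (verlet U δ z).1 i‖ ≤ 8 * Λ ^ 2 * totalNorm z i := by
    refine (norm_add_le _ _).trans ?_
    have : Λ * totalNorm z i ≤ Λ ^ 2 * totalNorm z i := by
      gcongr; nlinarith
    linarith [hF i]
  rw [h1, norm_neg, norm_smul, Real.norm_of_nonneg (by positivity)]
  calc _ ≤ δ / 2 * (8 * Λ ^ 2 * totalNorm z i) := by gcongr
    _ = _ := by ring

theorem totalNorm_verlet_le (h : NearlyDecoupled (∇ U) g L κ) (hL : 0 ≤ L) (hκ : 0 ≤ κ)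
    (hΛ : L + κ ≤ Λ) (hΛ1 : 1 ≤ Λ) (hδ : 0 ≤ δ) (hδ1 : δ ≤ 1)
    (z : BlockSpace d₀ q × BlockSpace d₀ q) (i : Fin d₀) :
    totalNorm (verlet U δ z) i ≤ (1 + 18 * Λ ^ 2 * δ) * totalNorm z i := by
  have h1 : ∀ j, blockNorm (verlet U δ z) j ≤ blockNorm z j + 6 * Λ ^ 2 * δ * totalNorm z j :=
    fun j => by
      obtain ⟨h1, h2⟩ := norm_verlet_sub_le h hL hκ hΛ hΛ1 hδ hδ1 z j
      have h3 : ‖(verlet U δ z).1 j‖ ≤ ‖(verlet U δ z).1 j - z.1 j‖ + ‖z.1 j‖ :=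
        norm_le_norm_sub_add _ _
      have h4 : ‖(verlet U δ z).2 j‖ ≤ ‖(verlet U δ z).2 j - z.2 j‖ + ‖z.2 j‖ :=
        norm_le_norm_sub_add _ _
      have h5 : Λ * δ * totalNorm z j ≤ Λ ^ 2 * δ * totalNorm z j := by
        have := totalNorm_nonneg z j
        gcongr; nlinarith
      unfold blockNorm
      linarith
  have h2 : blockMean (blockNorm (verlet U δ z)) ≤
      blockMean (blockNorm z) + 6 * Λ ^ 2 * δ * blockMean (totalNorm z) := by
    rw [← blockMean_const_mul, ← blockMean_add]
    exact blockMean_mono h1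
  have h3 : 6 * Λ ^ 2 * δ * blockMean (totalNorm z) ≤ 6 * Λ ^ 2 * δ * (2 * totalNorm z i) := by
    gcongr; exact blockMean_totalNorm z i
  have h4 := h1 i
  have h5 : totalNorm z i = blockNorm z i + blockMean (blockNorm z) := rfl
  rw [totalNorm]
  linarith

theorem totalNorm_verlet_iterate_le (h : NearlyDecoupled (∇ U) g L κ) (hL : 0 ≤ L) (hκ : 0 ≤ κ)
    (hΛ : L + κ ≤ Λ) (hΛ1 : 1 ≤ Λ) (hδ : 0 ≤ δ) (hδ1 : δ ≤ 1)
    (z : BlockSpace d₀ q × BlockSpace d₀ q) (i : Fin d₀) (k : ℕ) (hk : k * δ ≤ 1) :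
    totalNorm ((verlet U δ)^[k] z) i ≤ Real.exp (18 * Λ ^ 2) * totalNorm z i := by
  have hs := totalNorm_nonneg z i
  have h1 : totalNorm ((verlet U δ)^[k] z) i ≤
      (1 + 18 * Λ ^ 2 * δ) ^ k * totalNorm z i := by
    clear hk
    induction k with
    | zero => simp
    | succ k ih =>
      rw [Function.iterate_succ_apply']
      refine (totalNorm_verlet_le h hL hκ hΛ hΛ1 hδ hδ1 _ i).trans ?_
      rw [pow_succ' (1 + 18 * Λ ^ 2 * δ), mul_assoc (1 + 18 * Λ ^ 2 * δ)]
      gcongr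
  refine h1.trans ?_
  gcongr
  calc (1 + 18 * Λ ^ 2 * δ) ^ k ≤ Real.exp (18 * Λ ^ 2 * δ) ^ k := by
        gcongr
        linarith [Real.add_one_le_exp (18 * Λ ^ 2 * δ)]
    _ = Real.exp (18 * Λ ^ 2 * (k * δ)) := by rw [← Real.exp_nat_mul]; ring_nf
    _ ≤ _ := by
        exact Real.exp_le_exp.2 (mul_le_of_le_one_right (by positivity) hk)

/-- After a time `k δ ≤ 1` the Verlet trajectory is `O(k δ)`-close to its starting point, relative to
`totalNorm`. -/
theorem norm_verlet_iterate_sub_le (h : NearlyDecoupled (∇ U) g L κ) (hL : 0 ≤ L) (hκ : 0 ≤ κ)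
    (hΛ : L + κ ≤ Λ) (hΛ1 : 1 ≤ Λ) (hδ : 0 ≤ δ) (hδ1 : δ ≤ 1)
    (z : BlockSpace d₀ q × BlockSpace d₀ q) (i : Fin d₀) (k : ℕ) (hk : k * δ ≤ 1) :
    ‖((verlet U δ)^[k] z).1 i - z.1 i‖ ≤
        k * δ * (4 * Λ ^ 2 * Real.exp (18 * Λ ^ 2)) * totalNorm z i ∧
      ‖((verlet U δ)^[k] z).2 i - z.2 i‖ ≤
        k * δ * (4 * Λ ^ 2 * Real.exp (18 * Λ ^ 2)) * totalNorm z i := by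
  induction k with
  | zero => simp
  | succ k ih =>
    have hk' : (k : ℝ) * δ ≤ 1 := le_trans (by push_cast; linarith) hk
    obtain ⟨h1, h2⟩ := ih hk'
    rw [Function.iterate_succ_apply']
    set y := (verlet U δ)^[k] z
    obtain ⟨h3, h4⟩ := norm_verlet_sub_le h hL hκ hΛ hΛ1 hδ hδ1 y i
    have h5 := totalNorm_verlet_iterate_le h hL hκ hΛ hΛ1 hδ hδ1 z i k hk'
    have h6 : 4 * Λ ^ 2 * δ * totalNorm y i ≤
        4 * Λ ^ 2 * δ * (Real.exp (18 * Λ ^ 2) * totalNorm z i) := by gcongr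
    have h7 : 2 * Λ * δ * totalNorm y i ≤ 4 * Λ ^ 2 * δ * totalNorm y i := by
      have := totalNorm_nonneg y i
      gcongr ?_ * δ * _
      nlinarith
    push_cast
    constructor
    · have := norm_sub_le_norm_sub_add_norm_sub ((verlet U δ y).1 i) (y.1 i) (z.1 i)
      linarith
    · have := norm_sub_le_norm_sub_add_norm_sub ((verlet U δ y).2 i) (y.2 i) (z.2 i)
      linarith

/-- Over a time `k δ ≤ T` the Verlet trajectory is an explicit Euler step of the decoupled
dynamics up to an error of order `k δ (T + κ)`, relative to `totalNorm`. -/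
theorem norm_verlet_iterate_sub_euler_le (h : NearlyDecoupled (∇ U) g L κ) (hL : 0 ≤ L)
    (hκ : 0 ≤ κ) (hΛ : L + κ ≤ Λ) (hΛ1 : 1 ≤ Λ) (hδ : 0 ≤ δ) (hδT : δ ≤ T) (hT1 : T ≤ 1)
    (z : BlockSpace d₀ q × BlockSpace d₀ q) (i : Fin d₀) (k : ℕ) (hk : k * δ ≤ T) :
    ‖((verlet U δ)^[k] z).1 i - (z.1 i + (k * δ) • z.2 i)‖ ≤
        k * δ * (8 * Λ ^ 3 * Real.exp (18 * Λ ^ 2)) * (T + κ) * totalNorm z i ∧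
      ‖((verlet U δ)^[k] z).2 i - (z.2 i - (k * δ) • g (z.1 i))‖ ≤
        k * δ * (8 * Λ ^ 3 * Real.exp (18 * Λ ^ 2)) * (T + κ) * totalNorm z i := by
  set e := Real.exp (18 * Λ ^ 2) with he
  have he0 : 0 < e := Real.exp_pos _
  have hδ1 := hδT.trans hT1
  have hT0 := hδ.trans hδT
  have hs := totalNorm_nonneg z i
  have hforce : ∀ k : ℕ, k * δ ≤ T →
      ‖∇ U ((verlet U δ)^[k] z).1 i - g (z.1 i)‖ ≤ 8 * Λ ^ 3 * e * (T + κ) * totalNorm z i := by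
    intro k hk
    have hk1 := hk.trans hT1
    set y := (verlet U δ)^[k] z with hy
    have h1 := h.norm_sub_le hκ y i
    have h2 := h.lipschitz (z.1 i) (y.1 i)
    have h3 := totalNorm_verlet_iterate_le h hL hκ hΛ hΛ1 hδ hδ1 z i k hk1
    have h4 := (norm_verlet_iterate_sub_le h hL hκ hΛ hΛ1 hδ hδ1 z i k hk1).1
    rw [← hy, ← he] at h3 h4
    have h5 := norm_sub_le_norm_sub_add_norm_sub (∇ U y.1 i) (g (y.1 i)) (g (z.1 i))
    have h6 : κ * totalNorm y i ≤ κ * (e * totalNorm z i) := by gcongr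
    have h7 : L * ‖y.1 i - z.1 i‖ ≤ Λ * (T * (4 * Λ ^ 2 * e) * totalNorm z i) := by
      gcongr
      · linarith
      · exact h4.trans (by gcongr)
    have h8 : κ * (e * totalNorm z i) * 1 ≤ κ * (e * totalNorm z i) * Λ ^ 3 :=
      mul_le_mul_of_nonneg_left (one_le_pow₀ hΛ1) (by positivity)
    have h9 : 0 ≤ κ * (e * totalNorm z i) * Λ ^ 3 := by positivity
    have h10 : 0 ≤ Λ * (T * (4 * Λ ^ 2 * e) * totalNorm z i) := by positivity
    linarith
  induction k with
  | zero => simp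
  | succ k ih =>
    have hk' : (k : ℝ) * δ ≤ T := le_trans (by push_cast; linarith) hk
    obtain ⟨h1, h2⟩ := ih hk'
    have f1 := hforce k hk'
    have f2 := hforce (k + 1) hk
    have hn := (norm_verlet_iterate_sub_le h hL hκ hΛ hΛ1 hδ hδ1 z i k (hk'.trans hT1)).2
    have hF : ‖∇ U ((verlet U δ)^[k] z).1 i‖ ≤ Λ * (e * totalNorm z i) := by
      refine (h.norm_le hL hΛ _ i).trans ?_
      gcongr
      refine le_trans ?_ (totalNorm_verlet_iterate_le h hL hκ hΛ hΛ1 hδ hδ1 z i k (hk'.trans hT1))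
      unfold totalNorm
      gcongr
      · exact le_add_of_nonneg_right (norm_nonneg _)
      · exact blockMean_mono fun j => le_add_of_nonneg_right (norm_nonneg _)
    rw [Function.iterate_succ_apply'] at f2 ⊢
    rw [← he] at hn
    set y := (verlet U δ)^[k] z
    push_cast
    constructor
    · have e1 : (verlet U δ y).1 i - (z.1 i + ((k + 1) * δ) • z.2 i) =
          (y.1 i - (z.1 i + (k * δ) • z.2 i)) + δ • (y.2 i - z.2 i) -
            (δ * (δ / 2)) • ∇ U y.1 i := by
        rw [verlet_fst]; module
      have e2 : δ * ‖y.2 i - z.2 i‖ ≤ δ * (T * (4 * Λ ^ 2 * e) * totalNorm z i) := by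
        gcongr
        exact hn.trans (by gcongr)
      have e3 : (δ * (δ / 2)) * ‖∇ U y.1 i‖ ≤ (δ * (T / 2)) * (Λ * (e * totalNorm z i)) := by
        gcongr
      have e4 : δ * T * e * totalNorm z i * Λ ^ 2 ≤ δ * T * e * totalNorm z i * Λ ^ 3 := by
        gcongr; norm_num
      have e5 : δ * T * e * totalNorm z i * Λ ≤ δ * T * e * totalNorm z i * Λ ^ 3 := by
        gcongr
        exact le_self_pow₀ hΛ1 (by norm_num)
      have e6 : 0 ≤ δ * κ * e * totalNorm z i * Λ ^ 3 := by positivity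
      have e7 : 0 ≤ δ * T * e * totalNorm z i * Λ ^ 3 := by positivity
      rw [e1]
      refine (norm_sub_le _ _).trans ?_
      have e8 := norm_add_le (y.1 i - (z.1 i + (k * δ) • z.2 i)) (δ • (y.2 i - z.2 i))
      rw [norm_smul, Real.norm_of_nonneg hδ] at e8
      rw [norm_smul, Real.norm_of_nonneg (by positivity)]
      linarith
    · have e1 : (verlet U δ y).2 i - (z.2 i - ((k + 1) * δ) • g (z.1 i)) =
          (y.2 i - (z.2 i - (k * δ) • g (z.1 i))) -
            (δ / 2) • ((∇ U y.1 i - g (z.1 i)) + (∇ U (verlet U δ y).1 i - g (z.1 i))) := by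
        rw [verlet_snd]; module
      rw [e1]
      refine (norm_sub_le _ _).trans ?_
      rw [norm_smul, Real.norm_of_nonneg (by positivity)]
      have e2 := norm_add_le (∇ U y.1 i - g (z.1 i)) (∇ U (verlet U δ y).1 i - g (z.1 i))
      have e3 : δ / 2 * ‖(∇ U y.1 i - g (z.1 i)) + (∇ U (verlet U δ y).1 i - g (z.1 i))‖ ≤
          δ / 2 * (2 * (8 * Λ ^ 3 * e * (T + κ) * totalNorm z i)) := by
        gcongr; linarith
      linarith

end Verlet

/-! ### The modified energy of one block -/

section Energy

variable {E : Type*} [NormedAddCommGroup E] [InnerProductSpace ℝ E]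

/-- The modified energy of one block. For the Langevin dynamics with friction `γ` its time
derivative is `-(γ/2) (|v|² + ⟪x, ∇U x⟫)` plus a noise term; the constant `c` is there to make it
nonnegative. -/
noncomputable def energy (U : E → ℝ) (γ c : ℝ) (x v : E) : ℝ :=
  U x - U 0 + ‖v‖ ^ 2 / 2 + γ / 2 * ⟪x, v⟫_ℝ + γ ^ 2 / 4 * ‖x‖ ^ 2 + c

variable {U : E → ℝ} {L γ c : ℝ}

/-- Coercivity of the modified energy. It holds without a quadratic lower bound on `U`, since the
quadratic form in `(x, v)` is positive definite. -/
theorem le_energy (hγ : 0 < γ) (x v : E) (hlow : -c ≤ U x - U 0) :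
    min (1 / 8) (γ ^ 2 / 12) * (‖x‖ ^ 2 + ‖v‖ ^ 2) ≤ energy U γ c x v := by
  have h1 := (abs_le.1 (abs_real_inner_le_norm x v)).1
  have h2 : min (1 / 8) (γ ^ 2 / 12) * ‖x‖ ^ 2 ≤ γ ^ 2 / 12 * ‖x‖ ^ 2 := by
    gcongr; exact min_le_right _ _
  have h3 : min (1 / 8) (γ ^ 2 / 12) * ‖v‖ ^ 2 ≤ 1 / 8 * ‖v‖ ^ 2 := by
    gcongr; exact min_le_left _ _
  have h4 : γ / 2 * -(‖x‖ * ‖v‖) ≤ γ / 2 * ⟪x, v⟫_ℝ := by gcongr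
  have h5 := sq_nonneg (γ * ‖x‖ - 3 / 2 * ‖v‖)
  unfold energy
  nlinarith

theorem energy_le (hγ : 0 < γ) (hL : 0 ≤ L) (x v : E) (hup : U x - U 0 ≤ L * ‖x‖ ^ 2) :
    energy U γ c x v ≤ (1 + L + γ + γ ^ 2) * (‖x‖ ^ 2 + ‖v‖ ^ 2) + c := by
  have h1 := real_inner_le_norm x v
  have h4 : γ / 2 * ⟪x, v⟫_ℝ ≤ γ / 2 * (‖x‖ * ‖v‖) := by gcongr
  have h5 := mul_nonneg hγ.le (sq_nonneg (‖x‖ - ‖v‖))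
  have h6 : 0 ≤ L * ‖v‖ ^ 2 := by positivity
  have h7 : 0 ≤ γ * ‖v‖ ^ 2 := by positivity
  have h8 : 0 ≤ γ ^ 2 * ‖v‖ ^ 2 := by positivity
  have h9 : 0 ≤ γ * ‖x‖ ^ 2 := by positivity
  have h10 : 0 ≤ γ ^ 2 * ‖x‖ ^ 2 := by positivity
  unfold energy
  nlinarith [sq_nonneg ‖x‖, sq_nonneg ‖v‖]

/-- Change of the modified energy along an approximate explicit Euler step of the Hamiltonian
dynamics. -/
theorem energy_euler_le {T e D s : ℝ} {x v x' v' G : E} (hγ : 0 < γ) (hL : 0 ≤ L) (hT : 0 ≤ T)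
    (he : 0 ≤ e) (heD : e ≤ D * s) (hx : ‖x‖ ≤ s) (hv : ‖v‖ ≤ s)
    (hG : ‖G‖ ≤ L * ‖x‖) (hD : 0 ≤ D)
    (hU : U x' - U x - ⟪G, x' - x⟫_ℝ ≤ L * ‖x' - x‖ ^ 2)
    (hx' : ‖x' - (x + T • v)‖ ≤ T * e) (hv' : ‖v' - (v - T • G)‖ ≤ T * e) :
    energy U γ c x' v' ≤ energy U γ c x v +
      T * (γ / 2 * ‖v‖ ^ 2 - γ / 2 * ⟪x, G⟫_ℝ + γ ^ 2 / 2 * ⟪x, v⟫_ℝ) +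
      (1 + L + γ + γ ^ 2) * (1 + L + D) ^ 2 * (T * (T * s ^ 2 + s * e)) := by
  have hs : 0 ≤ s := (norm_nonneg x).trans hx
  have hGs : ‖G‖ ≤ L * s := hG.trans (by gcongr)
  obtain ⟨p, hp⟩ : ∃ p, x' = x + (T • v + p) := ⟨x' - (x + T • v), by abel⟩
  obtain ⟨r, hr⟩ : ∃ r, v' = v + (r - T • G) := ⟨v' - (v - T • G), by abel⟩
  have hpe : ‖p‖ ≤ T * e := by
    convert hx' using 2; rw [hp]; abel
  have hre : ‖r‖ ≤ T * e := by
    convert hv' using 2; rw [hr]; abel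
  set a := T • v + p with ha
  set b := r - T • G with hb
  set H := 1 + L + D with hH
  have hTe : T * e ≤ T * (D * s) := by gcongr
  have haH : ‖a‖ ≤ T * H * s := by
    have h1 := norm_add_le (T • v) p
    rw [norm_smul, Real.norm_of_nonneg hT] at h1
    have h2 : T * ‖v‖ ≤ T * s := by gcongr
    have h3 : 0 ≤ T * L * s := by positivity
    rw [hH]; linarith
  have hbH : ‖b‖ ≤ T * H * s := by
    have h1 := norm_sub_le r (T • G)
    rw [norm_smul, Real.norm_of_nonneg hT] at h1
    have h2 : T * ‖G‖ ≤ T * (L * s) := by gcongr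
    have h3 : 0 ≤ T * s := by positivity
    rw [hH]; linarith
  have hx'x : x' - x = a := by rw [hp]; abel
  rw [hx'x] at hU
  -- the quadratic terms
  have q1 : ‖a‖ ^ 2 ≤ (T * H * s) ^ 2 := by gcongr
  have q2 : ‖b‖ ^ 2 ≤ (T * H * s) ^ 2 := by gcongr
  have q3 : ⟪a, b⟫_ℝ ≤ (T * H * s) ^ 2 := by
    rw [sq]
    exact (real_inner_le_norm a b).trans (by gcongr)
  -- the linear terms in the errors `p`, `r`
  have l1 : ⟪G, p⟫_ℝ ≤ L * s * (T * e) := (real_inner_le_norm _ _).trans (by gcongr)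
  have l2 : ⟪v, r⟫_ℝ ≤ s * (T * e) := (real_inner_le_norm _ _).trans (by gcongr)
  have l3 : ⟪p, v⟫_ℝ ≤ s * (T * e) := by
    rw [real_inner_comm]; exact (real_inner_le_norm _ _).trans (by gcongr)
  have l4 : ⟪x, r⟫_ℝ ≤ s * (T * e) := (real_inner_le_norm _ _).trans (by gcongr)
  have l5 : ⟪x, p⟫_ℝ ≤ s * (T * e) := (real_inner_le_norm _ _).trans (by gcongr)
  have e1 : ⟪G, a⟫_ℝ = T * ⟪v, G⟫_ℝ + ⟪G, p⟫_ℝ := by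
    rw [ha, inner_add_right, real_inner_smul_right, real_inner_comm]
  have e2 : ⟪v, b⟫_ℝ = ⟪v, r⟫_ℝ - T * ⟪v, G⟫_ℝ := by
    rw [hb, inner_sub_right, real_inner_smul_right]
  have e3 : ⟪a, v⟫_ℝ = T * ‖v‖ ^ 2 + ⟪p, v⟫_ℝ := by
    rw [ha, inner_add_left, real_inner_smul_left, real_inner_self_eq_norm_sq]
  have e4 : ⟪x, b⟫_ℝ = ⟪x, r⟫_ℝ - T * ⟪x, G⟫_ℝ := by
    rw [hb, inner_sub_right, real_inner_smul_right]
  have e5 : ⟪x, a⟫_ℝ = T * ⟪x, v⟫_ℝ + ⟪x, p⟫_ℝ := by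
    rw [ha, inner_add_right, real_inner_smul_right]
  have e6 : ‖v'‖ ^ 2 = ‖v‖ ^ 2 + 2 * ⟪v, b⟫_ℝ + ‖b‖ ^ 2 := by rw [hr, norm_add_sq_real]
  have e7 : ‖x'‖ ^ 2 = ‖x‖ ^ 2 + 2 * ⟪x, a⟫_ℝ + ‖a‖ ^ 2 := by rw [hp, norm_add_sq_real]
  have e8 : ⟪x', v'⟫_ℝ = ⟪x, v⟫_ℝ + ⟪a, v⟫_ℝ + ⟪x, b⟫_ℝ + ⟪a, b⟫_ℝ := by
    rw [hp, hr, inner_add_left, inner_add_right, inner_add_right]; ring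
  set t := T * H * s
  set u := s * (T * e) with hu
  have hH1 : 1 ≤ H := by rw [hH]; linarith
  have hu0 : 0 ≤ u := by positivity
  have hmain : energy U γ c x' v' ≤ energy U γ c x v +
      T * (γ / 2 * ‖v‖ ^ 2 - γ / 2 * ⟪x, G⟫_ℝ + γ ^ 2 / 2 * ⟪x, v⟫_ℝ) +
      (1 + L + γ + γ ^ 2) * (t ^ 2 + u) := by
    unfold energy
    rw [e6, e7, e8, e2, e3, e4, e5]
    rw [e1] at hU
    have m1 : L * ‖a‖ ^ 2 ≤ L * t ^ 2 := by gcongr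
    have m2 : γ / 2 * ⟪a, b⟫_ℝ ≤ γ / 2 * t ^ 2 := by gcongr
    have m3 : γ ^ 2 / 4 * ‖a‖ ^ 2 ≤ γ ^ 2 / 4 * t ^ 2 := by gcongr
    have m4 : γ / 2 * ⟪p, v⟫_ℝ ≤ γ / 2 * u := by gcongr
    have m5 : γ / 2 * ⟪x, r⟫_ℝ ≤ γ / 2 * u := by gcongr
    have m6 : γ ^ 2 / 2 * ⟪x, p⟫_ℝ ≤ γ ^ 2 / 2 * u := by gcongr
    have m7 : ⟪G, p⟫_ℝ ≤ L * u := by rw [hu]; linarith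
    have n1 : 0 ≤ t ^ 2 := sq_nonneg t
    have n2 : 0 ≤ γ * t ^ 2 := by positivity
    have n3 : 0 ≤ γ ^ 2 * t ^ 2 := by positivity
    have n4 : 0 ≤ γ ^ 2 * u := by positivity
    linarith
  refine hmain.trans ?_
  have hH2 : 1 ≤ H ^ 2 := one_le_pow₀ hH1
  have : t ^ 2 + u ≤ H ^ 2 * (T * (T * s ^ 2 + s * e)) := by
    have h1 : t ^ 2 = H ^ 2 * (T * (T * s ^ 2)) := by simp only [t]; ring
    have h2 : u ≤ H ^ 2 * u := le_mul_of_one_le_left hu0 hH2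
    have h3 : H ^ 2 * u = H ^ 2 * (T * (s * e)) := by rw [hu]; ring
    linarith
  rw [mul_assoc _ (H ^ 2)]
  gcongr

/-- Change of the modified energy under partial velocity refreshment, to which the first-order
change under the Hamiltonian dynamics is added. Only the sum is dissipative. The term linear in
the noise `w` is kept exactly, as it averages out. -/
theorem energy_refresh_le {T m M σ η : ℝ} {x v w G : E} (hγ : 0 < γ) (hT : 0 ≤ T)
    (hγT : γ * T ≤ 1) (hη : η = 1 - γ * T) (hσ : σ ^ 2 = 1 - η ^ 2)
    (hdrift : m * ‖x‖ ^ 2 - M ≤ ⟪x, G⟫_ℝ) (hM : 0 ≤ M) :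
    energy U γ c x (η • v + σ • w) +
      T * (γ / 2 * ‖η • v + σ • w‖ ^ 2 - γ / 2 * ⟪x, G⟫_ℝ +
        γ ^ 2 / 2 * ⟪x, η • v + σ • w⟫_ℝ) ≤
    energy U γ c x v + σ * ⟪η • v + (γ / 2) • x, w⟫_ℝ
      - min (γ / 2) (γ * m / 2) * T * (‖x‖ ^ 2 + ‖v‖ ^ 2)
      + (2 * γ + 2 * γ ^ 2 + γ ^ 3 + γ * M) *
        (T * (T * (‖x‖ ^ 2 + ‖v‖ ^ 2) + ‖w‖ ^ 2 + 1)) := by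
  have hη0 : 0 ≤ η := by rw [hη]; linarith
  have hη1 : η ≤ 1 := by rw [hη]; have := mul_nonneg hγ.le hT; linarith
  have hσ2 : σ ^ 2 ≤ 2 * γ * T := by rw [hσ, hη]; nlinarith [sq_nonneg (γ * T)]
  have e1 : ‖η • v + σ • w‖ ^ 2 = η ^ 2 * ‖v‖ ^ 2 + 2 * (η * σ * ⟪v, w⟫_ℝ) + σ ^ 2 * ‖w‖ ^ 2 := by
    rw [norm_add_sq_real, norm_smul, norm_smul, real_inner_smul_left, real_inner_smul_right,
      mul_pow, mul_pow, Real.norm_eq_abs, Real.norm_eq_abs, sq_abs, sq_abs]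
    ring
  have e2 : ⟪x, η • v + σ • w⟫_ℝ = η * ⟪x, v⟫_ℝ + σ * ⟪x, w⟫_ℝ := by
    rw [inner_add_right, real_inner_smul_right, real_inner_smul_right]
  have e3 : ⟪η • v + (γ / 2) • x, w⟫_ℝ = η * ⟪v, w⟫_ℝ + γ / 2 * ⟪x, w⟫_ℝ := by
    rw [inner_add_left, real_inner_smul_left, real_inner_smul_left]
  set A := ‖x‖ ^ 2 with hA
  set B := ‖v‖ ^ 2 with hB
  set N := ‖w‖ ^ 2 with hN
  have hA0 : 0 ≤ A := sq_nonneg _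
  have hB0 : 0 ≤ B := sq_nonneg _
  have hN0 : 0 ≤ N := sq_nonneg _
  have t1 : (η ^ 2 - 1) / 2 * B + T * (γ / 2) * (η ^ 2 * B) ≤ -(γ / 2) * T * B := by
    have h1 : η ^ 2 ≤ η := by nlinarith
    have h2 : (η ^ 2 - 1) / 2 + T * (γ / 2) * η ^ 2 = γ * T / 2 * (η ^ 2 - η - 1) := by
      rw [hη]; ring
    have h3 : γ * T / 2 * (η ^ 2 - η - 1) ≤ γ * T / 2 * (-1) := by gcongr; linarith
    have h4 := mul_le_mul_of_nonneg_right (h2.le.trans h3) hB0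
    linarith
  have t2 : γ / 2 * (η - 1) * ⟪x, v⟫_ℝ + T * (γ ^ 2 / 2) * (η * ⟪x, v⟫_ℝ) ≤
      γ ^ 3 / 4 * T ^ 2 * (A + B) := by
    have h1 := (abs_le.1 (abs_real_inner_le_norm x v)).1
    have h2 := sq_nonneg (‖x‖ - ‖v‖)
    have h3 : -⟪x, v⟫_ℝ ≤ (A + B) / 2 := by rw [hA, hB]; linarith
    have h4 : γ / 2 * (η - 1) * ⟪x, v⟫_ℝ + T * (γ ^ 2 / 2) * (η * ⟪x, v⟫_ℝ) =
        γ ^ 3 / 2 * T ^ 2 * (-⟪x, v⟫_ℝ) := by rw [hη]; ring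
    have h5 : γ ^ 3 / 2 * T ^ 2 * (-⟪x, v⟫_ℝ) ≤ γ ^ 3 / 2 * T ^ 2 * ((A + B) / 2) := by gcongr
    linarith
  have t3 : σ ^ 2 / 2 * N + T * (γ / 2) * (σ ^ 2 * N) ≤ 2 * γ * (T * N) := by
    have h1 : σ ^ 2 * N ≤ 2 * γ * T * N := by gcongr
    have h2 : T * (γ / 2) * (σ ^ 2 * N) ≤ 1 / 2 * (σ ^ 2 * N) := by
      gcongr; linarith
    linarith
  have hcross : ∀ y : E, ∀ a : ℝ, 0 ≤ a → T * a * (σ * ⟪y, w⟫_ℝ) ≤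
      a / 2 * (T ^ 2 * ‖y‖ ^ 2 + 2 * γ * T * N) := by
    intro y a ha
    have h1 : (T * σ) * ⟪y, w⟫_ℝ ≤ (T ^ 2 * ‖y‖ ^ 2 + σ ^ 2 * N) / 2 := by
      have h2 := (le_abs_self _).trans_eq (abs_mul (T * σ) ⟪y, w⟫_ℝ)
      have h3 : |T * σ| * |⟪y, w⟫_ℝ| ≤ |T * σ| * (‖y‖ * ‖w‖) := by
        gcongr; exact abs_real_inner_le_norm y w
      rw [abs_mul, abs_of_nonneg hT] at h2 h3
      have h4 := sq_nonneg (T * ‖y‖ - |σ| * ‖w‖)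
      have h5 := sq_abs σ
      rw [hN, ← h5]
      linarith
    have h2 : σ ^ 2 * N ≤ 2 * γ * T * N := by gcongr
    have h3 : a * ((T * σ) * ⟪y, w⟫_ℝ) ≤ a * ((T ^ 2 * ‖y‖ ^ 2 + 2 * γ * T * N) / 2) := by
      gcongr; linarith
    linarith
  have t4 : T * γ * (η * (σ * ⟪v, w⟫_ℝ)) ≤ γ / 2 * (T ^ 2 * B + 2 * γ * T * N) := by
    have h1 := hcross v (γ * η) (by positivity)
    have h2 : γ * η / 2 * (T ^ 2 * ‖v‖ ^ 2 + 2 * γ * T * N) ≤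
        γ * 1 / 2 * (T ^ 2 * ‖v‖ ^ 2 + 2 * γ * T * N) := by gcongr
    linarith
  have t5 : T * (γ ^ 2 / 2) * (σ * ⟪x, w⟫_ℝ) ≤ γ ^ 2 / 4 * (T ^ 2 * A + 2 * γ * T * N) := by
    have h1 := hcross x (γ ^ 2 / 2) (by positivity)
    linarith
  have t6 : T * (γ / 2) * (m * A - M) ≤ T * (γ / 2) * ⟪x, G⟫_ℝ := by gcongr
  have t7 : min (γ / 2) (γ * m / 2) * T * A ≤ γ * m / 2 * T * A := by
    gcongr; exact min_le_right _ _
  have t8 : min (γ / 2) (γ * m / 2) * T * B ≤ γ / 2 * T * B := by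
    gcongr; exact min_le_left _ _
  unfold energy
  rw [e1, e2, e3]
  have n1 : 0 ≤ γ * T ^ 2 * A := by positivity
  have n2 : 0 ≤ γ * T ^ 2 * B := by positivity
  have n3 : 0 ≤ γ ^ 2 * T ^ 2 * A := by positivity
  have n4 : 0 ≤ γ ^ 2 * T ^ 2 * B := by positivity
  have n5 : 0 ≤ γ ^ 3 * T ^ 2 * A := by positivity
  have n6 : 0 ≤ γ ^ 3 * T ^ 2 * B := by positivity
  have n7 : 0 ≤ γ ^ 3 * T * N := by positivity
  have n8 : 0 ≤ γ * T := by positivity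
  have n9 : 0 ≤ γ ^ 2 * T := by positivity
  have n10 : 0 ≤ γ ^ 3 * T := by positivity
  have n11 : 0 ≤ γ * M * T := by positivity
  have n13 : 0 ≤ γ * (T * N) := by positivity
  have n14 : 0 ≤ γ ^ 2 * (T * N) := by positivity
  have n12 : 0 ≤ γ * M * (T * (T * (A + B) + N)) := by positivity
  linarith

end Energy

/-! ### Gaussian symmetry and moments -/

section Gaussian

section Symmetry

variable {E : Type*} [NormedAddCommGroup E] [InnerProductSpace ℝ E] [FiniteDimensional ℝ E]
  [MeasurableSpace E] [BorelSpace E]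

/-- By symmetry of the Gaussian measure a function may be averaged over `±g` before it is
integrated; no measurability is needed for this upper bound. -/
theorem lintegral_stdGaussian_le_of_add_neg_le {f h : E → ℝ≥0∞}
    (hfh : ∀ g, f g + f (-g) ≤ 2 * h g) :
    ∫⁻ g, f g ∂(stdGaussian E) ≤ ∫⁻ g, h g ∂(stdGaussian E) := by
  have hneg : ∫⁻ g, f (-g) ∂(stdGaussian E) = ∫⁻ g, f g ∂(stdGaussian E) := by
    have h1 := stdGaussian_map (LinearIsometryEquiv.neg ℝ : E ≃ₗᵢ[ℝ] E)
    have h2 := lintegral_map_equiv (μ := stdGaussian E) f (MeasurableEquiv.neg E)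
    have h3 : Measure.map (MeasurableEquiv.neg E) (stdGaussian E) = stdGaussian E := h1
    rw [h3] at h2
    exact h2.symm
  have h2 : 2 * ∫⁻ g, f g ∂(stdGaussian E) ≤ 2 * ∫⁻ g, h g ∂(stdGaussian E) := by
    calc 2 * ∫⁻ g, f g ∂(stdGaussian E)
        = ∫⁻ g, f g ∂(stdGaussian E) + ∫⁻ g, f (-g) ∂(stdGaussian E) := by rw [hneg, two_mul]
      _ ≤ ∫⁻ g, (f g + f (-g)) ∂(stdGaussian E) := le_lintegral_add _ _
      _ ≤ ∫⁻ g, 2 * h g ∂(stdGaussian E) := lintegral_mono hfh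
      _ = _ := lintegral_const_mul' _ _ (by norm_num)
  exact (ENNReal.mul_le_mul_iff_right (by norm_num) (by norm_num)).1 h2

end Symmetry

/-- The sixth moment of the standard real Gaussian. -/
noncomputable def sixthMoment : ℝ := ∫ t, t ^ 6 ∂(gaussianReal 0 1)

theorem lintegral_pow_six_gaussianReal :
    ∫⁻ t, ENNReal.ofReal (t ^ 6) ∂(gaussianReal 0 1) = ENNReal.ofReal sixthMoment := by
  refine (ofReal_integral_eq_lintegral_ofReal ?_ ?_).symm
  · have := (memLp_id_gaussianReal (μ := 0) (v := 1) 6).integrable_norm_pow (p := 6) (by norm_num)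
    refine this.congr (Filter.Eventually.of_forall fun t => ?_)
    simp [Even.pow_abs (n := 6) (by decide)]
  · exact Filter.Eventually.of_forall fun t => Even.pow_nonneg (n := 6) (by decide) t

theorem sixthMoment_nonneg : 0 ≤ sixthMoment :=
  integral_nonneg fun t => Even.pow_nonneg (n := 6) (by decide) t

variable {d₀ q : ℕ}

theorem map_coord_stdGaussian (i : Fin d₀) (k : Fin q) :
    (stdGaussian (BlockSpace d₀ q)).map (fun g => g i k) = gaussianReal 0 1 := by
  let e : BlockSpace d₀ q := PiLp.single 2 i (EuclideanSpace.single k (1 : ℝ))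
  let l : StrongDual ℝ (BlockSpace d₀ q) := InnerProductSpace.toDual ℝ _ e
  have hl : (fun g : BlockSpace d₀ q => g i k) = l := by
    ext g
    simp only [l, InnerProductSpace.toDual_apply_apply, PiLp.inner_apply, e]
    rw [Finset.sum_eq_single i, Finset.sum_eq_single k]
    · simp
    · intro b _ hb; simp [hb]
    · simp
    · intro b _ hb; simp [hb]
    · simp
  have hnorm : ‖l‖ = 1 := by
    simp [l, e]
  have h := IsGaussian.map_eq_gaussianReal (μ := stdGaussian (BlockSpace d₀ q)) l
  rw [integral_strongDual_stdGaussian, variance_dual_stdGaussian, hnorm] at h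
  rw [hl, h]
  simp

theorem lintegral_norm_block_pow_six_le (i : Fin d₀) :
    ∫⁻ g, ENNReal.ofReal (‖g i‖ ^ 6) ∂(stdGaussian (BlockSpace d₀ q)) ≤
      ENNReal.ofReal (sixthMoment * q ^ 3) := by
  have hpt : ∀ g : BlockSpace d₀ q, ‖g i‖ ^ 6 ≤ (q : ℝ) ^ 2 * ∑ k, g i k ^ 6 := fun g => by
    have h1 : ‖g i‖ ^ 6 = (∑ k, g i k ^ 2) ^ 3 := by
      rw [← EuclideanSpace.real_norm_sq_eq]; ring
    have h3 : (∑ k, g i k ^ 2) ^ 3 ≤ (q : ℝ) ^ 2 * ∑ k, (g i k ^ 2) ^ 3 := by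
      simpa using pow_sum_le_card_mul_sum_pow (s := Finset.univ) (f := fun k => g i k ^ 2)
        (fun k _ => sq_nonneg _) 2
    rw [h1]
    simpa [← pow_mul] using h3
  calc ∫⁻ g, ENNReal.ofReal (‖g i‖ ^ 6) ∂(stdGaussian (BlockSpace d₀ q))
      ≤ ∫⁻ g, ENNReal.ofReal ((q : ℝ) ^ 2) * ∑ k, ENNReal.ofReal (g i k ^ 6)
          ∂(stdGaussian (BlockSpace d₀ q)) := by
        refine lintegral_mono fun g => ?_
        rw [← ENNReal.ofReal_sum_of_nonneg fun k _ => Even.pow_nonneg (n := 6) (by decide) _,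
          ← ENNReal.ofReal_mul (by positivity)]
        exact ENNReal.ofReal_le_ofReal (hpt g)
    _ = ENNReal.ofReal ((q : ℝ) ^ 2) * ∑ k : Fin q, ENNReal.ofReal sixthMoment := by
        rw [lintegral_const_mul' _ _ ENNReal.ofReal_ne_top, lintegral_finsetSum]
        · congr 1
          refine Finset.sum_congr rfl fun k _ => ?_
          rw [← lintegral_pow_six_gaussianReal, ← map_coord_stdGaussian i k,
            lintegral_map (by fun_prop) (by fun_prop)]
        · intro k _
          fun_prop
    _ = ENNReal.ofReal (sixthMoment * q ^ 3) := by
        rw [Finset.sum_const, Finset.card_univ, Fintype.card_fin, nsmul_eq_mul,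
          ← ENNReal.ofReal_natCast, ← ENNReal.ofReal_mul (by positivity),
          ← ENNReal.ofReal_mul (by positivity)]
        ring_nf

theorem lintegral_add_sum_norm_pow_six_le {a b : ℝ} (ha : 0 ≤ a) (hb : 0 ≤ b) :
    ∫⁻ g, ENNReal.ofReal (a + b * ∑ i, ‖g i‖ ^ 6) ∂(stdGaussian (BlockSpace d₀ q)) ≤
      ENNReal.ofReal (a + b * (sixthMoment * (d₀ * q ^ 3))) := by
  have h6 := sixthMoment_nonneg
  calc ∫⁻ g, ENNReal.ofReal (a + b * ∑ i, ‖g i‖ ^ 6) ∂(stdGaussian (BlockSpace d₀ q))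
      = ∫⁻ g, (ENNReal.ofReal a + ENNReal.ofReal b * ∑ i, ENNReal.ofReal (‖g i‖ ^ 6))
          ∂(stdGaussian (BlockSpace d₀ q)) := by
        refine lintegral_congr fun g => ?_
        rw [ENNReal.ofReal_add ha (by positivity), ENNReal.ofReal_mul hb,
          ENNReal.ofReal_sum_of_nonneg fun i _ => by positivity]
    _ = ENNReal.ofReal a + ENNReal.ofReal b *
          ∑ i, ∫⁻ g, ENNReal.ofReal (‖g i‖ ^ 6) ∂(stdGaussian (BlockSpace d₀ q)) := by
        rw [lintegral_add_left measurable_const, lintegral_const, measure_univ, mul_one,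
          lintegral_const_mul' _ _ ENNReal.ofReal_ne_top, lintegral_finsetSum]
        intro i _
        fun_prop
    _ ≤ ENNReal.ofReal a + ENNReal.ofReal b *
          ∑ _i : Fin d₀, ENNReal.ofReal (sixthMoment * q ^ 3) := by
        gcongr with i
        exact lintegral_norm_block_pow_six_le i
    _ = _ := by
        rw [Finset.sum_const, Finset.card_univ, Fintype.card_fin, nsmul_eq_mul,
          ← ENNReal.ofReal_natCast, ← ENNReal.ofReal_mul (by positivity),
          ← ENNReal.ofReal_mul hb, ← ENNReal.ofReal_add ha (by positivity)]
        ring_nf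

end Gaussian

/-! ### Energy of a block over one step -/

section Drift

variable {d₀ q : ℕ}

/-- The modified energy of the `i`-th block of a phase space point. -/
noncomputable def blockEnergy (Uq : EuclideanSpace ℝ (Fin q) → ℝ) (γ c : ℝ)
    (z : BlockSpace d₀ q × BlockSpace d₀ q) (i : Fin d₀) : ℝ :=
  energy Uq γ c (z.1 i) (z.2 i)

/-- The phase space point reached from `z` by velocity refreshment with noise `σ g`. -/
def refresh (η σ : ℝ) (z : BlockSpace d₀ q × BlockSpace d₀ q) (g : BlockSpace d₀ q) :
    BlockSpace d₀ q × BlockSpace d₀ q :=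
  (z.1, η • z.2 + σ • g)

theorem blockNorm_refresh_le {η σ : ℝ} (hη : 0 ≤ η) (hη1 : η ≤ 1) (hσ : 0 ≤ σ) (hσ1 : σ ≤ 1)
    (z : BlockSpace d₀ q × BlockSpace d₀ q) (g : BlockSpace d₀ q) (i : Fin d₀) :
    blockNorm (refresh η σ z g) i ≤ blockNorm z i + ‖g i‖ := by
  have h1 : ‖η • z.2 i + σ • g i‖ ≤ η * ‖z.2 i‖ + σ * ‖g i‖ := by
    refine (norm_add_le _ _).trans_eq ?_
    rw [norm_smul, norm_smul, Real.norm_of_nonneg hη, Real.norm_of_nonneg hσ]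
  have h2 : η * ‖z.2 i‖ ≤ ‖z.2 i‖ := mul_le_of_le_one_left (norm_nonneg _) hη1
  have h3 : σ * ‖g i‖ ≤ ‖g i‖ := mul_le_of_le_one_left (norm_nonneg _) hσ1
  simp only [blockNorm, refresh, PiLp.add_apply, PiLp.smul_apply]
  linarith

theorem totalNorm_refresh_sq_le {η σ c₀ : ℝ} (hη : 0 ≤ η) (hη1 : η ≤ 1) (hσ : 0 ≤ σ)
    (hσ1 : σ ≤ 1) (hc₀ : 0 < c₀) {R : Fin d₀ → ℝ} (z : BlockSpace d₀ q × BlockSpace d₀ q)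
    (hR : ∀ i, c₀ * (‖z.1 i‖ ^ 2 + ‖z.2 i‖ ^ 2) ≤ R i) (g : BlockSpace d₀ q) (i : Fin d₀) :
    totalNorm (refresh η σ z g) i ^ 2 ≤
      8 / c₀ * (R i + blockMean R) + 4 * (‖g i‖ ^ 2 + blockMean fun j => ‖g j‖ ^ 2) := by
  have : NeZero d₀ := ⟨fun h => by subst h; exact i.elim0⟩
  have hb : ∀ j, blockNorm (refresh η σ z g) j ^ 2 ≤ 4 / c₀ * R j + 2 * ‖g j‖ ^ 2 := fun j => by
    have h1 := blockNorm_refresh_le hη hη1 hσ hσ1 z g j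
    have h2 : blockNorm (refresh η σ z g) j ^ 2 ≤ (blockNorm z j + ‖g j‖) ^ 2 :=
      pow_le_pow_left₀ (blockNorm_nonneg _ _) h1 2
    have h3 : blockNorm z j ^ 2 ≤ 2 * (‖z.1 j‖ ^ 2 + ‖z.2 j‖ ^ 2) := by
      unfold blockNorm; exact add_sq_le
    have h4 : (blockNorm z j + ‖g j‖) ^ 2 ≤ 2 * (blockNorm z j ^ 2 + ‖g j‖ ^ 2) := add_sq_le
    have h5 : 4 * (‖z.1 j‖ ^ 2 + ‖z.2 j‖ ^ 2) ≤ 4 / c₀ * R j := by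
      rw [div_mul_eq_mul_div, le_div_iff₀ hc₀]
      linarith [hR j]
    linarith
  have h1 : blockMean (blockNorm (refresh η σ z g)) ^ 2 ≤
      4 / c₀ * blockMean R + 2 * blockMean fun j => ‖g j‖ ^ 2 := by
    rw [← blockMean_const_mul, ← blockMean_const_mul, ← blockMean_add]
    exact (blockMean_pow_le (blockNorm_nonneg _) 2).trans (blockMean_mono hb)
  have h2 : totalNorm (refresh η σ z g) i ^ 2 ≤
      2 * (blockNorm (refresh η σ z g) i ^ 2 + blockMean (blockNorm (refresh η σ z g)) ^ 2) :=
    add_sq_le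
  have h3 := hb i
  have h4 : 8 / c₀ * (R i + blockMean R) = 2 * (4 / c₀ * R i) + 2 * (4 / c₀ * blockMean R) := by
    ring
  linarith

theorem blockEnergy_lower {Uq Wq : EuclideanSpace ℝ (Fin q) → ℝ} {LU LW m M γ : ℝ} (hm : 0 < m)
    (hM : 0 ≤ M) (hγ : 0 < γ) (h : PotentialAssumption Uq Wq LU LW m M)
    (z : BlockSpace d₀ q × BlockSpace d₀ q) (i : Fin d₀) :
    min (1 / 8) (γ ^ 2 / 12) * (‖z.1 i‖ ^ 2 + ‖z.2 i‖ ^ 2) ≤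
      blockEnergy Uq γ (LU * (M / m)) z i :=
  le_energy hγ _ _ (le_sub_of_drift hm hM h.contDiff_U h.hessian_U_le h.gradient_U_zero
    h.drift_U _)

theorem blockEnergy_upper {Uq Wq : EuclideanSpace ℝ (Fin q) → ℝ} {LU LW m M γ : ℝ}
    (hLU : 0 ≤ LU) (hγ : 0 < γ) (h : PotentialAssumption Uq Wq LU LW m M)
    (z : BlockSpace d₀ q × BlockSpace d₀ q) (i : Fin d₀) :
    blockEnergy Uq γ (LU * (M / m)) z i ≤
      (1 + LU + γ + γ ^ 2) * (‖z.1 i‖ ^ 2 + ‖z.2 i‖ ^ 2) + LU * (M / m) :=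
  energy_le hγ hLU _ _ (abs_le.1 (abs_sub_le_of_gradient_zero h.contDiff_U h.hessian_U_le
    h.gradient_U_zero _)).2

theorem blockEnergy_nonneg {Uq Wq : EuclideanSpace ℝ (Fin q) → ℝ} {LU LW m M γ : ℝ} (hm : 0 < m)
    (hM : 0 ≤ M) (hγ : 0 < γ) (h : PotentialAssumption Uq Wq LU LW m M)
    (z : BlockSpace d₀ q × BlockSpace d₀ q) (i : Fin d₀) :
    0 ≤ blockEnergy Uq γ (LU * (M / m)) z i :=
  le_trans (by positivity) (blockEnergy_lower hm hM hγ h z i)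

/-- The change of the modified energy of a block over `K` Verlet steps is, to first order in the
total time `T`, its derivative along the Hamiltonian dynamics of that block alone. -/
theorem blockEnergy_verlet_iterate_le {Uq Wq : EuclideanSpace ℝ (Fin q) → ℝ}
    {LU LW m M γ c ε δ T Λ Cv w D : ℝ} {K : ℕ} (hLU : 0 ≤ LU) (hLW : 0 ≤ LW) (hγ : 0 < γ)
    (h : PotentialAssumption Uq Wq LU LW m M) (hε : 0 ≤ ε) (hε1 : ε ≤ 1) (hδ : 0 ≤ δ) (hK : 1 ≤ K)
    (hT : T = K * δ) (hT1 : T ≤ 1) (hΛ : Λ = 1 + LU + 2 * LW)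
    (hCv : Cv = 8 * Λ ^ 3 * Real.exp (18 * Λ ^ 2)) (hw : w = 1 + 2 * LW) (hD : D = Cv * (w * 2))
    (y : BlockSpace d₀ q × BlockSpace d₀ q) (i : Fin d₀) :
    blockEnergy Uq γ c ((verlet (meanFieldPotential d₀ Uq Wq ε) δ)^[K] y) i ≤
      blockEnergy Uq γ c y i +
        T * (γ / 2 * ‖y.2 i‖ ^ 2 - γ / 2 * ⟪y.1 i, ∇ Uq (y.1 i)⟫_ℝ +
          γ ^ 2 / 2 * ⟪y.1 i, y.2 i⟫_ℝ) +
        (1 + LU + γ + γ ^ 2) * (1 + LU + D) ^ 2 * (1 + Cv * w) *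
          (T * ((T + ε) * totalNorm y i ^ 2)) := by
  have hΛ1 : 1 ≤ Λ := by rw [hΛ]; linarith
  have hCv0 : 0 ≤ Cv := by rw [hCv]; positivity
  have hw0 : 0 ≤ w := by rw [hw]; positivity
  have hD0 : 0 ≤ D := by rw [hD]; positivity
  have hT0 : 0 ≤ T := by rw [hT]; positivity
  have hδT : δ ≤ T := by
    rw [hT]; exact le_mul_of_one_le_left hδ (by exact_mod_cast hK)
  have hdec := nearlyDecoupled_gradient (d₀ := d₀) h hε
  have hκ0 : 0 ≤ 2 * LW * ε := by positivity
  have hκΛ : LU + 2 * LW * ε ≤ Λ := by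
    have : 2 * LW * ε ≤ 2 * LW := mul_le_of_le_one_right (by positivity) hε1
    rw [hΛ]; linarith
  have hκθ : T + 2 * LW * ε ≤ w * (T + ε) := by
    have := mul_nonneg hLW hT0
    rw [hw]; linarith
  have hv := norm_verlet_iterate_sub_euler_le hdec hLU hκ0 hκΛ hΛ1 hδ hδT hT1 y i K hT.ge
  rw [← hT, ← hCv] at hv
  generalize (verlet (meanFieldPotential d₀ Uq Wq ε) δ)^[K] y = y' at hv ⊢
  have hs0 : 0 ≤ totalNorm y i := totalNorm_nonneg y i
  have hys : blockNorm y i ≤ totalNorm y i := blockNorm_le_totalNorm y i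
  generalize totalNorm y i = s at hv hs0 hys ⊢
  have hθ2 : T + ε ≤ 2 := by linarith
  have hθT : T ≤ T + ε := by linarith
  have hθ0 : 0 ≤ T + ε := by linarith
  generalize T + ε = θ at hκθ hθ2 hθT hθ0 ⊢
  obtain ⟨v1, v2⟩ := hv
  have hΦ : T * Cv * (T + 2 * LW * ε) * s ≤ T * (Cv * (w * θ) * s) := by
    calc _ = T * (Cv * (T + 2 * LW * ε) * s) := by ring
      _ ≤ _ := by gcongr
  have hyx : ‖y.1 i‖ ≤ s := le_trans (le_add_of_nonneg_right (norm_nonneg _)) hys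
  have hyv : ‖y.2 i‖ ≤ s := le_trans (le_add_of_nonneg_left (norm_nonneg _)) hys
  have E1 := energy_euler_le (c := c) hγ hLU hT0 (e := Cv * (w * θ) * s) (D := D) (by positivity)
    (by rw [hD]; gcongr) hyx hyv
    (norm_gradient_le h.contDiff_U h.hessian_U_le h.gradient_U_zero (y.1 i)) hD0
    (le_of_abs_le (abs_sub_sub_inner_gradient_le h.contDiff_U h.hessian_U_le (y.1 i) _))
    (v1.trans hΦ) (v2.trans hΦ)
  refine E1.trans ?_
  rw [mul_assoc ((1 + LU + γ + γ ^ 2) * (1 + LU + D) ^ 2) (1 + Cv * w)]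
  unfold blockEnergy
  have h2 : T * s ^ 2 ≤ θ * s ^ 2 := by gcongr
  have h3 : T * (T * s ^ 2 + s * (Cv * (w * θ) * s)) ≤ T * ((1 + Cv * w) * (θ * s ^ 2)) := by
    gcongr; linarith
  have h4 : (1 + Cv * w) * (T * (θ * s ^ 2)) = T * ((1 + Cv * w) * (θ * s ^ 2)) := by ring
  rw [h4]
  gcongr

/-- One step of the algorithm, for a fixed realization `g` of the noise: the energy of a block
contracts up to a term linear in `g`, small multiples of the energies, and powers of the noise.
The constants do not depend on the dimensions. -/
theorem exists_blockEnergy_step (LU LW m M γ : ℝ) (hLU : 0 ≤ LU) (hLW : 0 ≤ LW) (hm : 0 < m)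
    (hM : 0 ≤ M) (hγ : 0 < γ) :
    ∃ C c₁ : ℝ, 0 < C ∧ 0 < c₁ ∧
      ∀ (d₀ q : ℕ) (Uq Wq : EuclideanSpace ℝ (Fin q) → ℝ), PotentialAssumption Uq Wq LU LW m M →
      ∀ (ε δ T η σ : ℝ) (K : ℕ), 0 ≤ ε → ε ≤ 1 → 0 ≤ δ → 1 ≤ K → T = K * δ → T ≤ 1 → γ * T ≤ 1 →
        η = 1 - γ * T → 0 ≤ σ → σ ^ 2 = 1 - η ^ 2 →
      ∀ (z : BlockSpace d₀ q × BlockSpace d₀ q) (g : BlockSpace d₀ q) (i : Fin d₀),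
        blockEnergy Uq γ (LU * (M / m))
            ((verlet (meanFieldPotential d₀ Uq Wq ε) δ)^[K] (refresh η σ z g)) i ≤
          (1 - c₁ * T) * blockEnergy Uq γ (LU * (M / m)) z i +
            σ * ⟪η • z.2 i + (γ / 2) • z.1 i, g i⟫_ℝ +
            C * T * ((T + ε) * (blockEnergy Uq γ (LU * (M / m)) z i +
                blockMean (blockEnergy Uq γ (LU * (M / m)) z)) +
              (1 + ‖g i‖ ^ 2 + blockMean fun j => ‖g j‖ ^ 2)) := by
  set c := LU * (M / m) with hc
  have hc0 : 0 ≤ c := by positivity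
  set c₀ := min (1 / 8) (γ ^ 2 / 12) with hc₀
  have hc₀0 : 0 < c₀ := by rw [hc₀]; positivity
  set Cu := 1 + LU + γ + γ ^ 2 with hCu
  have hCu0 : 0 < Cu := by positivity
  set Λ := 1 + LU + 2 * LW with hΛ
  set w := 1 + 2 * LW with hw
  set Cv := 8 * Λ ^ 3 * Real.exp (18 * Λ ^ 2) with hCv
  have hΛ1 : 1 ≤ Λ := by rw [hΛ]; linarith
  have hCv0 : 0 < Cv := by positivity
  have hw0 : 0 < w := by positivity
  set D := Cv * (w * 2) with hD
  have hD0 : 0 < D := by positivity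
  set C₁ := Cu * (1 + LU + D) ^ 2 with hC₁
  have hC₁0 : 0 < C₁ := by positivity
  set C₂ := C₁ * (1 + Cv * w) with hC₂
  have hC₂0 : 0 < C₂ := by positivity
  set C₃ := 2 * γ + 2 * γ ^ 2 + γ ^ 3 + γ * M with hC₃
  have hC₃0 : 0 < C₃ := by positivity
  set μ := min (γ / 2) (γ * m / 2) with hμ
  have hμ0 : 0 < μ := by rw [hμ]; positivity
  refine ⟨C₂ * (8 / c₀ + 8) + C₃ * (1 / c₀ + 1) + μ / Cu * c, μ / Cu, by positivity,
    by positivity, ?_⟩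
  clear_value c c₀ Cu Λ w Cv D C₁ C₂ C₃ μ
  intro d₀ q Uq Wq h ε δ T η σ K hε hε1 hδ hK hT hT1 hγT hη hσ hση z g i
  have hT0 : 0 ≤ T := by rw [hT]; positivity
  have hη0 : 0 ≤ η := by rw [hη]; linarith
  have hη1 : η ≤ 1 := by rw [hη]; have := mul_nonneg hγ.le hT0; linarith
  have hσ1 : σ ≤ 1 := (sq_le_one_iff₀ hσ).1 (by rw [hση]; linarith [sq_nonneg η])
  set y := refresh η σ z g with hy
  set R := blockEnergy Uq γ c z with hR
  set s := totalNorm y i with hs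
  have hs0 : 0 ≤ s := totalNorm_nonneg y i
  set θ := T + ε with hθ
  have hθ0 : 0 ≤ θ := by positivity
  have hκθ : T + 2 * LW * ε ≤ w * θ := by
    have := mul_nonneg hLW hT0
    rw [hw, hθ]; linarith
  have E1 := blockEnergy_verlet_iterate_le (c := c) hLU hLW hγ h hε hε1 hδ hK hT hT1 hΛ hCv hw hD
    y i
  have E2 := energy_refresh_le (c := c) (U := Uq) (x := z.1 i) (v := z.2 i) (w := g i) hγ hT0 hγT
    hη hση (h.drift_U (z.1 i)) hM
  have hy1 : y.1 i = z.1 i := rfl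
  have hy2 : y.2 i = η • z.2 i + σ • g i := rfl
  rw [hy1, hy2, ← hCu, ← hC₁, ← hC₂, ← hθ, ← hs] at E1
  rw [← hμ, ← hC₃] at E2
  have hlow := blockEnergy_lower hm hM hγ h z
  have hup := blockEnergy_upper hLU hγ h z i
  rw [← hc, ← hCu, ← hR] at hup
  rw [← hc₀, ← hc, ← hR] at hlow
  have hsq := totalNorm_refresh_sq_le hη0 hη1 hσ hσ1 hc₀0 z hlow g i
  rw [← hy, ← hs] at hsq
  set A := ‖z.1 i‖ ^ 2 + ‖z.2 i‖ ^ 2 with hA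
  set N := ‖g i‖ ^ 2 + blockMean fun j => ‖g j‖ ^ 2 with hN
  have hgN : ‖g i‖ ^ 2 ≤ N := le_add_of_nonneg_right (blockMean_nonneg fun j => sq_nonneg _)
  have hN0 : 0 ≤ N := (sq_nonneg _).trans hgN
  have hR0 : ∀ j, 0 ≤ R j := fun j => by rw [hR, hc]; exact blockEnergy_nonneg hm hM hγ h z j
  have hRi := hR0 i
  have hRm : 0 ≤ blockMean R := blockMean_nonneg hR0
  have hAR : A ≤ 1 / c₀ * R i := by
    rw [one_div_mul_eq_div, le_div_iff₀ hc₀0]; linarith [hlow i]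
  have hRA : R i / Cu - c / Cu ≤ A := by
    rw [← sub_div, div_le_iff₀ hCu0]; linarith
  -- the error of the Euler approximation
  have F1 : C₂ * (T * (θ * s ^ 2)) ≤
      C₂ * T * ((8 / c₀) * (θ * (R i + blockMean R)) + 8 * N) := by
    have h3 : θ * s ^ 2 ≤ θ * (8 / c₀ * (R i + blockMean R) + 4 * N) := by gcongr
    have h4 : θ * (4 * N) ≤ 2 * (4 * N) := by gcongr; rw [hθ]; linarith
    rw [mul_assoc C₂]
    gcongr
    linarith
  have F2 : C₃ * (T * (T * A + ‖g i‖ ^ 2 + 1)) ≤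
      C₃ * T * ((1 / c₀) * (θ * (R i + blockMean R)) + (1 + N)) := by
    have h1 : T * A ≤ θ * (1 / c₀ * (R i + blockMean R)) := by
      gcongr
      · rw [hθ]; linarith
      · refine hAR.trans ?_
        gcongr
        linarith
    have h2 : T * A + ‖g i‖ ^ 2 + 1 ≤ (1 / c₀) * (θ * (R i + blockMean R)) + (1 + N) := by
      linarith
    rw [mul_assoc C₃]
    gcongr C₃ * (T * ?_)
  have F3 : -(μ * T * A) ≤ -(μ / Cu * T * R i) + μ / Cu * c * T := by
    have h1 : μ * T * (R i / Cu - c / Cu) ≤ μ * T * A := by gcongr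
    have h2 : μ * T * (R i / Cu - c / Cu) = μ / Cu * T * R i - μ / Cu * c * T := by ring
    linarith
  have hgoal : blockEnergy Uq γ c ((verlet (meanFieldPotential d₀ Uq Wq ε) δ)^[K] y) i ≤
      energy Uq γ c (z.1 i) (z.2 i) + σ * ⟪η • z.2 i + (γ / 2) • z.1 i, g i⟫_ℝ
        - μ * T * A + C₃ * (T * (T * A + ‖g i‖ ^ 2 + 1)) +
        C₂ * (T * (θ * s ^ 2)) := by
    have hye : blockEnergy Uq γ c y i = energy Uq γ c (z.1 i) (η • z.2 i + σ • g i) := rfl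
    linarith
  have hRe : energy Uq γ c (z.1 i) (z.2 i) = R i := rfl
  rw [hRe] at hgoal
  set X := θ * (R i + blockMean R) with hX
  have hX0 : 0 ≤ X := by positivity
  have p1 : 0 ≤ C₂ * T * (8 / c₀) * (1 + N) := by positivity
  have p2 : 0 ≤ C₂ * T * 8 * (X + 1) := by positivity
  have p3 : 0 ≤ C₃ * T * (1 / c₀) * (1 + N) := by positivity
  have p4 : 0 ≤ C₃ * T * X := by positivity
  have p5 : 0 ≤ μ / Cu * c * T * (X + N) := by positivity
  have hfin : (1 - μ / Cu * T) * R i + σ * ⟪η • z.2 i + (γ / 2) • z.1 i, g i⟫_ℝ +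
      (C₂ * (8 / c₀ + 8) + C₃ * (1 / c₀ + 1) + μ / Cu * c) * T * (X + (1 + N)) =
      (R i + σ * ⟪η • z.2 i + (γ / 2) • z.1 i, g i⟫_ℝ) +
      (-(μ / Cu * T * R i) + μ / Cu * c * T) +
      C₂ * T * ((8 / c₀) * X + 8 * N) + C₃ * T * ((1 / c₀) * X + (1 + N)) +
      (C₂ * T * (8 / c₀) * (1 + N) + C₂ * T * 8 * (X + 1) + C₃ * T * (1 / c₀) * (1 + N) +
        C₃ * T * X + μ / Cu * c * T * (X + N)) := by ring
  have hNa : 1 + ‖g i‖ ^ 2 + (blockMean fun j => ‖g j‖ ^ 2) = 1 + N := by rw [hN]; ring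
  rw [hNa, hfin]
  refine hgoal.trans ?_
  linarith

end Drift

/-! ### Cubes of energies, and iteration of a drift inequality -/

section Cubic

theorem add_add_pow_three_le {a b c : ℝ} (ha : 0 ≤ a) (hb : 0 ≤ b) (hc : 0 ≤ c) :
    (a + b + c) ^ 3 ≤ 9 * (a ^ 3 + b ^ 3 + c ^ 3) := by
  have h := pow_sum_le_card_mul_sum_pow (s := Finset.univ) (f := ![a, b, c])
    (by intro i _; fin_cases i <;> simpa) 2
  simp [Fin.sum_univ_three] at h
  linarith

/-- A Young inequality: the left-hand side collects the cross terms that arise in the cube of the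
energy. -/
theorem cross_terms_le {κ r y : ℝ} (hκ : 0 < κ) (hκ1 : κ ≤ 1) (hr : 0 ≤ r) (hy : 0 ≤ y) :
    6 * r ^ 2 * y + 6 * r * y ^ 2 + y ^ 3 ≤ 12 * κ * r ^ 3 + (12 / κ ^ 2 + 1) * y ^ 3 := by
  rcases le_total y (κ * r) with h | h
  · have h1 : r ^ 2 * y ≤ r ^ 2 * (κ * r) := by gcongr
    have h2 : r * y ^ 2 ≤ r * (κ * r) ^ 2 := by gcongr
    have h3 : r * (κ * r) ^ 2 ≤ κ * r ^ 3 := by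
      have : κ ^ 2 * r ^ 3 ≤ κ * r ^ 3 := by gcongr; nlinarith
      linarith
    have h4 : 0 ≤ 12 / κ ^ 2 * y ^ 3 := by positivity
    linarith
  · have hr' : r ≤ y / κ := by rw [le_div_iff₀ hκ]; linarith
    have h1 : r ^ 2 * y ≤ (y / κ) ^ 2 * y := by gcongr
    have h2 : r * y ^ 2 ≤ y / κ * y ^ 2 := by gcongr
    have h3 : y / κ * y ^ 2 ≤ (y / κ) ^ 2 * y := by
      have e1 : y / κ * y ^ 2 = y ^ 3 * (1 / κ) := by ring
      have e2 : (y / κ) ^ 2 * y = y ^ 3 * (1 / κ) ^ 2 := by ring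
      rw [e1, e2]
      gcongr
      exact le_self_pow₀ ((one_le_div hκ).2 hκ1) (by norm_num)
    have h4 : 12 / κ ^ 2 * y ^ 3 = 12 * ((y / κ) ^ 2 * y) := by ring
    have h5 : 0 ≤ 12 * κ * r ^ 3 := by positivity
    linarith

/-- Passing from the energy to its cube. The values `a`, `b` stand for the energy of a block after
a step with noise `g` and `-g`, so that the linear terms `±S` cancel at first order and only `S²`,
which is of order `T`, remains. -/
theorem exists_cube_contraction {C c₁ : ℝ} (hC : 0 < C) (hc₁ : 0 < c₁) :
    ∃ θ₀ C' : ℝ, 0 < θ₀ ∧ 0 < C' ∧ ∀ θ T r r' N S a b : ℝ, 0 ≤ θ → θ ≤ θ₀ → 0 ≤ T → T ≤ 1 →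
      c₁ * T ≤ 1 → 0 ≤ r → 0 ≤ r' → 0 ≤ N → 0 ≤ a → 0 ≤ b → S ^ 2 ≤ C * T * r * N →
      a ≤ (1 - c₁ * T) * r + S + C * T * (θ * (r + r') + N) →
      b ≤ (1 - c₁ * T) * r - S + C * T * (θ * (r + r') + N) →
      a ^ 3 + b ^ 3 ≤
        2 * ((1 - 3 / 4 * c₁ * T) * r ^ 3 + T * (c₁ / 4 * r' ^ 3 + C' * N ^ 3)) := by
  -- Young's inequality is applied with a parameter `κ` that costs at most `c₁ / 8` of the rate
  obtain ⟨κ, hκ0, hκ1, hκc⟩ : ∃ κ : ℝ, 0 < κ ∧ κ ≤ 1 ∧ 12 * κ ≤ c₁ / 8 :=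
    ⟨min 1 (c₁ / 96), by positivity, min_le_left _ _, by
      linarith [min_le_right 1 (c₁ / 96)]⟩
  set A := 12 / κ ^ 2 + 1 with hA
  have hA0 : 0 < A := by positivity
  refine ⟨min 1 (c₁ / (72 * A * C ^ 3)), 9 * A * C ^ 3, by positivity, by positivity, ?_⟩
  intro θ T r r' N S a b hθ hθ₀ hT hT1 hcT hr hr' hN ha hb hS ha' hb'
  have hθ1 : θ ≤ 1 := hθ₀.trans (min_le_left _ _)
  have hθc : 9 * A * C ^ 3 * θ ^ 3 ≤ c₁ / 8 := by
    have h1 : θ ^ 3 ≤ θ := pow_le_of_le_one hθ hθ1 (by norm_num)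
    have h2 : θ ≤ c₁ / (72 * A * C ^ 3) := hθ₀.trans (min_le_right _ _)
    calc 9 * A * C ^ 3 * θ ^ 3 ≤ 9 * A * C ^ 3 * (c₁ / (72 * A * C ^ 3)) := by
          gcongr; exact h1.trans h2
      _ = c₁ / 8 := by field_simp; norm_num
  set y := C * (θ * (r + r') + N) with hy
  have hy0 : 0 ≤ y := by positivity
  have hCN : C * N ≤ y := by
    rw [hy]; gcongr; exact le_add_of_nonneg_left (by positivity)
  set p := (1 - c₁ * T) * r with hp
  have hp0 : 0 ≤ p := mul_nonneg (by linarith) hr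
  have hpr : p ≤ r := mul_le_of_le_one_left hr (by have := mul_nonneg hc₁.le hT; linarith)
  have hyT : C * T * (θ * (r + r') + N) = T * y := by rw [hy]; ring
  rw [hyT] at ha' hb'
  set B := p + T * y with hB
  have hB0 : 0 ≤ B := by positivity
  have h1 : a ^ 3 ≤ (B + S) ^ 3 := pow_le_pow_left₀ ha (by linarith) 3
  have h2 : b ^ 3 ≤ (B - S) ^ 3 := pow_le_pow_left₀ hb (by linarith) 3
  have h3 : (B + S) ^ 3 + (B - S) ^ 3 = 2 * (B ^ 3 + 3 * B * S ^ 2) := by ring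
  have hTy : T * y ≤ y := mul_le_of_le_one_left hy0 hT1
  have h4 : 3 * B * S ^ 2 ≤ T * (3 * r ^ 2 * y + 3 * r * y ^ 2) := by
    have e1 : S ^ 2 ≤ T * r * y := by
      refine hS.trans ?_
      calc C * T * r * N = T * r * (C * N) := by ring
        _ ≤ _ := by gcongr
    calc 3 * B * S ^ 2 ≤ 3 * (r + y) * (T * r * y) := by
          gcongr
          rw [hB]; linarith
      _ = _ := by ring
  have h5 : B ^ 3 ≤ (1 - c₁ * T) * r ^ 3 + T * (3 * r ^ 2 * y + 3 * r * y ^ 2 + y ^ 3) := by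
    have e1 : B ^ 3 = p ^ 2 * p + T * (3 * p ^ 2 * y + 3 * p * y * (T * y) + y * (T * y) ^ 2) := by
      rw [hB]; ring
    have e2 : p ^ 2 * p ≤ r ^ 2 * p := by gcongr
    have e3 : T * (3 * p ^ 2 * y + 3 * p * y * (T * y) + y * (T * y) ^ 2) ≤
        T * (3 * r ^ 2 * y + 3 * r * y * y + y * y ^ 2) := by gcongr
    have e4 : r ^ 2 * p = (1 - c₁ * T) * r ^ 3 := by rw [hp]; ring
    linarith
  have h6 := cross_terms_le hκ0 hκ1 hr hy0
  rw [← hA] at h6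
  have h7 : A * y ^ 3 ≤ c₁ / 8 * (r ^ 3 + r' ^ 3) + 9 * A * C ^ 3 * N ^ 3 := by
    have e1 : y = C * (θ * r + θ * r' + N) := by rw [hy]; ring
    have e2 := add_add_pow_three_le (mul_nonneg hθ hr) (mul_nonneg hθ hr') hN
    calc A * y ^ 3 = A * C ^ 3 * (θ * r + θ * r' + N) ^ 3 := by rw [e1]; ring
      _ ≤ A * C ^ 3 * (9 * ((θ * r) ^ 3 + (θ * r') ^ 3 + N ^ 3)) := by gcongr
      _ = 9 * A * C ^ 3 * θ ^ 3 * (r ^ 3 + r' ^ 3) + 9 * A * C ^ 3 * N ^ 3 := by ring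
      _ ≤ _ := by gcongr
  have h8 : 12 * κ * r ^ 3 ≤ c₁ / 8 * r ^ 3 := by gcongr
  have h9 : T * (6 * r ^ 2 * y + 6 * r * y ^ 2 + y ^ 3) ≤
      T * (c₁ / 4 * r ^ 3 + c₁ / 4 * r' ^ 3 + 9 * A * C ^ 3 * N ^ 3) := by
    refine mul_le_mul_of_nonneg_left ?_ hT
    have : 0 ≤ c₁ / 8 * r' ^ 3 := by positivity
    linarith
  linarith

end Cubic

section Operator

variable {d₀ q : ℕ}

theorem iterate_verletOp (U : BlockSpace d₀ q → ℝ) (δ : ℝ) (k : ℕ)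
    (f : BlockSpace d₀ q × BlockSpace d₀ q → ℝ≥0∞) :
    (verletOp U δ)^[k] f = fun z => f ((verlet U δ)^[k] z) := by
  induction k generalizing f with
  | zero => rfl
  | succ k ih =>
    rw [Function.iterate_succ_apply, ih]
    funext z
    rw [Function.iterate_succ_apply', verletOp]

theorem ghmcOp_apply (U : BlockSpace d₀ q → ℝ) (K : ℕ) (δ η : ℝ)
    (f : BlockSpace d₀ q × BlockSpace d₀ q → ℝ≥0∞) (z : BlockSpace d₀ q × BlockSpace d₀ q) :
    ghmcOp U K δ η f z =
      ∫⁻ g, f ((verlet U δ)^[K] (refresh η (Real.sqrt (1 - η ^ 2)) z g))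
        ∂(stdGaussian (BlockSpace d₀ q)) := by
  rw [ghmcOp, iterate_verletOp]
  rfl

theorem ghmcOp_mono (U : BlockSpace d₀ q → ℝ) (K : ℕ) (δ η : ℝ) : Monotone (ghmcOp U K δ η) := by
  intro f g hfg z
  rw [ghmcOp_apply, ghmcOp_apply]
  exact lintegral_mono fun _ => hfg _

/-- No measurability of `F` is needed, because the function added to it is constant. -/
theorem ghmcOp_affine (U : BlockSpace d₀ q → ℝ) (K : ℕ) (δ η : ℝ)
    (F : BlockSpace d₀ q × BlockSpace d₀ q → ℝ) {a b : ℝ} (ha : 0 ≤ a) (hb : 0 ≤ b)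
    (hF : ∀ z, 0 ≤ F z) (z : BlockSpace d₀ q × BlockSpace d₀ q) :
    ghmcOp U K δ η (fun y => ENNReal.ofReal (a * F y + b)) z =
      ENNReal.ofReal a * ghmcOp U K δ η (fun y => ENNReal.ofReal (F y)) z + ENNReal.ofReal b := by
  rw [ghmcOp_apply, ghmcOp_apply, ← lintegral_const_mul' _ _ ENNReal.ofReal_ne_top]
  have h : ∀ y, ENNReal.ofReal (a * F y + b) =
      ENNReal.ofReal a * ENNReal.ofReal (F y) + ENNReal.ofReal b := fun y => by
    rw [ENNReal.ofReal_add (mul_nonneg ha (hF y)) hb, ENNReal.ofReal_mul ha]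
  simp only [h]
  rw [lintegral_add_right _ measurable_const, lintegral_const, measure_univ, mul_one]

/-- A one-step drift inequality, iterated. The constant is written as `(1 - l) * B` so that the
geometric sum is `(1 - l ^ n) * B`. -/
theorem iterate_ghmcOp_le (U : BlockSpace d₀ q → ℝ) (K : ℕ) (δ η : ℝ)
    (F : BlockSpace d₀ q × BlockSpace d₀ q → ℝ) {l B : ℝ} (hl : 0 ≤ l) (hl1 : l ≤ 1) (hB : 0 ≤ B)
    (hF : ∀ z, 0 ≤ F z)
    (hstep : ∀ z, ghmcOp U K δ η (fun y => ENNReal.ofReal (F y)) z ≤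
      ENNReal.ofReal (l * F z + (1 - l) * B))
    (n : ℕ) {a b : ℝ} (ha : 0 ≤ a) (hb : 0 ≤ b) (z : BlockSpace d₀ q × BlockSpace d₀ q) :
    (ghmcOp U K δ η)^[n] (fun y => ENNReal.ofReal (a * F y + b)) z ≤
      ENNReal.ofReal (a * l ^ n * F z + a * B * (1 - l ^ n) + b) := by
  induction n generalizing a b with
  | zero => simp
  | succ n ih =>
    rw [Function.iterate_succ_apply]
    have h1 : ghmcOp U K δ η (fun y => ENNReal.ofReal (a * F y + b)) ≤
        fun y => ENNReal.ofReal ((a * l) * F y + (a * ((1 - l) * B) + b)) := fun y => by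
      have hB' : 0 ≤ (1 - l) * B := mul_nonneg (by linarith) hB
      calc _ = _ := ghmcOp_affine U K δ η F ha hb hF y
        _ ≤ ENNReal.ofReal a * ENNReal.ofReal (l * F y + (1 - l) * B) + ENNReal.ofReal b := by
            gcongr; exact hstep y
        _ = _ := by
            have := hF y
            rw [← ENNReal.ofReal_mul ha, ← ENNReal.ofReal_add (by positivity) hb]
            ring_nf
    refine ((ghmcOp_mono U K δ η).iterate n h1 z).trans ?_
    refine (ih (mul_nonneg ha hl) (add_nonneg (mul_nonneg ha
      (mul_nonneg (by linarith) hB)) hb)).trans_eq ?_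
    ring_nf

end Operator

/-! ### The drift inequality for the cubic energy -/

section Lyapunov

variable {d₀ q : ℕ}

/-- The Lyapunov function of the drift inequality: the sum of the cubes of the block energies. -/
noncomputable def cubicEnergy (Uq : EuclideanSpace ℝ (Fin q) → ℝ) (γ c : ℝ)
    (z : BlockSpace d₀ q × BlockSpace d₀ q) : ℝ :=
  ∑ i, blockEnergy Uq γ c z i ^ 3

theorem add_pow_six_le {a b : ℝ} (ha : 0 ≤ a) (hb : 0 ≤ b) :
    (a + b) ^ 6 ≤ 32 * (a ^ 6 + b ^ 6) := by
  have := add_pow_le ha hb 6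
  norm_num at this
  exact this

/-- Contraction of the cubic energy in one step of the algorithm, averaged over the noises `±g`.
It is pointwise in `g`; the remainder involves the sixth powers of the noise. -/
theorem exists_cubicEnergy_step (LU LW m M γ : ℝ) (hLU : 0 ≤ LU) (hLW : 0 ≤ LW) (hm : 0 < m)
    (hM : 0 ≤ M) (hγ : 0 < γ) :
    ∃ θ₀ C c₁ : ℝ, 0 < θ₀ ∧ 0 < C ∧ 0 < c₁ ∧ θ₀ ≤ 1 ∧ γ * θ₀ ≤ 1 ∧ c₁ * θ₀ ≤ 1 ∧
      ∀ (d₀ q : ℕ) (Uq Wq : EuclideanSpace ℝ (Fin q) → ℝ), PotentialAssumption Uq Wq LU LW m M →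
      ∀ (ε δ T η σ : ℝ) (K : ℕ), 0 ≤ ε → ε ≤ θ₀ → 0 ≤ δ → 1 ≤ K → T = K * δ → T ≤ θ₀ →
        η = 1 - γ * T → 0 ≤ σ → σ ^ 2 = 1 - η ^ 2 →
      ∀ (z : BlockSpace d₀ q × BlockSpace d₀ q) (g : BlockSpace d₀ q),
        cubicEnergy Uq γ (LU * (M / m))
            ((verlet (meanFieldPotential d₀ Uq Wq ε) δ)^[K] (refresh η σ z g)) +
          cubicEnergy Uq γ (LU * (M / m))
            ((verlet (meanFieldPotential d₀ Uq Wq ε) δ)^[K] (refresh η σ z (-g))) ≤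
        2 * ((1 - c₁ * T) * cubicEnergy Uq γ (LU * (M / m)) z + C * T * d₀ +
          C * T * ∑ i, ‖g i‖ ^ 6) := by
  obtain ⟨C₁, c₁, hC₁, hc₁, hstep⟩ := exists_blockEnergy_step LU LW m M γ hLU hLW hm hM hγ
  set c₀ := min (1 / 8) (γ ^ 2 / 12) with hc₀
  have hc₀0 : 0 < c₀ := by rw [hc₀]; positivity
  clear_value c₀
  obtain ⟨C₂, hC₂⟩ : ∃ x, x = C₁ + 4 * γ * (1 + γ ^ 2) / c₀ := ⟨_, rfl⟩
  have hC₂0 : 0 < C₂ := by rw [hC₂]; positivity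
  obtain ⟨θ₁, C', hθ₁, hC', hcube⟩ := exists_cube_contraction hC₂0 hc₁
  -- `θ₁` bounds the sum `T + ε`, hence the factor `1 / 2`
  refine ⟨min (min 1 (θ₁ / 2)) (min (1 / γ) (1 / c₁)), 18 * C', c₁ / 2, by positivity,
    by positivity, by positivity, (min_le_left _ _).trans (min_le_left _ _), ?_, ?_, ?_⟩
  · rw [mul_comm, ← le_div_iff₀ hγ]; exact (min_le_right _ _).trans (min_le_left _ _)
  · rw [mul_comm]
    have h1 : min (min 1 (θ₁ / 2)) (min (1 / γ) (1 / c₁)) ≤ 1 / c₁ :=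
      (min_le_right _ _).trans (min_le_right _ _)
    rw [le_div_iff₀ hc₁] at h1
    linarith
  intro d₀ q Uq Wq h ε δ T η σ K hε hε₀ hδ hK hT hT₀ hη hσ hση z g
  simp only [le_min_iff] at hε₀ hT₀
  obtain ⟨⟨hε1, hεθ⟩, -⟩ := hε₀
  obtain ⟨⟨hT1, hTθ⟩, hTγ, hTc⟩ := hT₀
  rw [le_div_iff₀ hγ, mul_comm] at hTγ
  rw [le_div_iff₀ hc₁, mul_comm] at hTc
  have hT0 : 0 ≤ T := by rw [hT]; positivity
  have hη0 : 0 ≤ η := by rw [hη]; linarith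
  have hη1 : η ≤ 1 := by rw [hη]; have := mul_nonneg hγ.le hT0; linarith
  have hσ2 : σ ^ 2 ≤ 2 * γ * T := by rw [hση, hη]; nlinarith [sq_nonneg (γ * T)]
  have hst := hstep d₀ q Uq Wq h ε δ T η σ K hε hε1 hδ hK hT hT1 hTγ hη hσ hση z
  have hlow := blockEnergy_lower hm hM hγ h z
  rw [← hc₀] at hlow
  have hnn : ∀ z : BlockSpace d₀ q × BlockSpace d₀ q, ∀ i,
      0 ≤ blockEnergy Uq γ (LU * (M / m)) z i := blockEnergy_nonneg hm hM hγ h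
  unfold cubicEnergy
  generalize hc : LU * (M / m) = c at hst hlow hnn ⊢
  rw [← Finset.sum_add_distrib]
  set R := blockEnergy Uq γ c z with hR
  have hblock : ∀ i, blockEnergy Uq γ c
        ((verlet (meanFieldPotential d₀ Uq Wq ε) δ)^[K] (refresh η σ z g)) i ^ 3 +
      blockEnergy Uq γ c
        ((verlet (meanFieldPotential d₀ Uq Wq ε) δ)^[K] (refresh η σ z (-g))) i ^ 3 ≤
      2 * ((1 - 3 / 4 * c₁ * T) * R i ^ 3 + T * (c₁ / 4 * (blockMean fun j => R j ^ 3) +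
        9 * C' * (1 + ‖g i‖ ^ 6 + blockMean fun j => ‖g j‖ ^ 6))) := by
    intro i
    have : NeZero d₀ := ⟨fun h => by subst h; exact i.elim0⟩
    have h1 := hst g i
    have h2 := hst (-g) i
    have hG : ∀ j, (-g) j = -(g j) := fun j => rfl
    simp only [hG, norm_neg, inner_neg_right] at h2
    set N := 1 + ‖g i‖ ^ 2 + blockMean fun j => ‖g j‖ ^ 2 with hN
    have hgm : 0 ≤ blockMean fun j => ‖g j‖ ^ 2 := blockMean_nonneg fun j => sq_nonneg _
    have hN0 : 0 ≤ N := by positivity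
    have hgN : ‖g i‖ ^ 2 ≤ N := by rw [hN]; linarith
    have hRm : 0 ≤ blockMean R := blockMean_nonneg (hnn z)
    have hRi : 0 ≤ R i := hnn z i
    have hX : C₁ * T * ((T + ε) * (R i + blockMean R) + N) ≤
        C₂ * T * ((T + ε) * (R i + blockMean R) + N) := by
      gcongr
      rw [hC₂]
      exact le_add_of_nonneg_right (by positivity)
    have hS : (σ * ⟪η • z.2 i + (γ / 2) • z.1 i, g i⟫_ℝ) ^ 2 ≤ C₂ * T * R i * N := by
      have e1 : ⟪η • z.2 i + (γ / 2) • z.1 i, g i⟫_ℝ ^ 2 ≤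
          ‖η • z.2 i + (γ / 2) • z.1 i‖ ^ 2 * ‖g i‖ ^ 2 := by
        rw [← mul_pow, ← sq_abs]
        exact pow_le_pow_left₀ (abs_nonneg _) (abs_real_inner_le_norm _ _) 2
      have e2 : ‖η • z.2 i + (γ / 2) • z.1 i‖ ^ 2 ≤
          2 * (1 + γ ^ 2) * (‖z.1 i‖ ^ 2 + ‖z.2 i‖ ^ 2) := by
        have f1 : ‖η • z.2 i + (γ / 2) • z.1 i‖ ≤ η * ‖z.2 i‖ + γ / 2 * ‖z.1 i‖ := by
          refine (norm_add_le _ _).trans_eq ?_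
          rw [norm_smul, norm_smul, Real.norm_of_nonneg hη0, Real.norm_of_nonneg (by positivity)]
        have f2 : ‖η • z.2 i + (γ / 2) • z.1 i‖ ^ 2 ≤
            2 * ((η * ‖z.2 i‖) ^ 2 + (γ / 2 * ‖z.1 i‖) ^ 2) :=
          (pow_le_pow_left₀ (norm_nonneg _) f1 2).trans add_sq_le
        have f3 : (η * ‖z.2 i‖) ^ 2 ≤ (1 * ‖z.2 i‖) ^ 2 := by gcongr
        have f4 : 0 ≤ γ ^ 2 * ‖z.1 i‖ ^ 2 := by positivity
        have f5 : 0 ≤ γ ^ 2 * ‖z.2 i‖ ^ 2 := by positivity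
        linarith [sq_nonneg ‖z.1 i‖]
      have e3 : ‖z.1 i‖ ^ 2 + ‖z.2 i‖ ^ 2 ≤ R i / c₀ := by
        rw [le_div_iff₀ hc₀0]; linarith [hlow i]
      calc (σ * ⟪η • z.2 i + (γ / 2) • z.1 i, g i⟫_ℝ) ^ 2
          = σ ^ 2 * ⟪η • z.2 i + (γ / 2) • z.1 i, g i⟫_ℝ ^ 2 := by ring
        _ ≤ (2 * γ * T) * ((2 * (1 + γ ^ 2) * (R i / c₀)) * N) := by
            gcongr
            refine e1.trans ?_
            gcongr
            exact e2.trans (by gcongr)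
        _ = 4 * γ * (1 + γ ^ 2) / c₀ * T * R i * N := by ring
        _ ≤ C₂ * T * R i * N := by
            gcongr
            rw [hC₂]
            exact le_add_of_nonneg_left hC₁.le
    have h3 := hcube (T + ε) T (R i) (blockMean R) N
      (σ * ⟪η • z.2 i + (γ / 2) • z.1 i, g i⟫_ℝ) _ _ (by positivity) (by linarith) hT0 hT1 hTc hRi
      hRm hN0 (hnn _ i) (hnn _ i) hS (h1.trans (by linarith)) (h2.trans (by linarith))
    refine h3.trans ?_
    have h4 : blockMean R ^ 3 ≤ blockMean fun j => R j ^ 3 := blockMean_pow_le (hnn z) 3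
    have h5 : N ^ 3 ≤ 9 * (1 + ‖g i‖ ^ 6 + blockMean fun j => ‖g j‖ ^ 6) := by
      have e1 := add_add_pow_three_le zero_le_one (sq_nonneg ‖g i‖) hgm
      have e2 : (blockMean fun j => ‖g j‖ ^ 2) ^ 3 ≤ blockMean fun j => (‖g j‖ ^ 2) ^ 3 :=
        blockMean_pow_le (fun j => sq_nonneg _) 3
      simp only [← pow_mul] at e1 e2
      norm_num at e1 e2
      linarith
    have h6 : C' * N ^ 3 ≤ C' * (9 * (1 + ‖g i‖ ^ 6 + blockMean fun j => ‖g j‖ ^ 6)) := by gcongr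
    have h7 : c₁ / 4 * blockMean R ^ 3 ≤ c₁ / 4 * blockMean fun j => R j ^ 3 := by gcongr
    have h8 : T * (c₁ / 4 * blockMean R ^ 3 + C' * N ^ 3) ≤
        T * (c₁ / 4 * (blockMean fun j => R j ^ 3) +
        9 * C' * (1 + ‖g i‖ ^ 6 + blockMean fun j => ‖g j‖ ^ 6)) := by
      refine mul_le_mul_of_nonneg_left ?_ hT0
      linarith
    linarith
  refine (Finset.sum_le_sum fun i _ => hblock i).trans ?_
  rcases Nat.eq_zero_or_pos d₀ with hd | hd
  · subst hd; simp
  have : NeZero d₀ := ⟨hd.ne'⟩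
  simp only [← Finset.mul_sum, Finset.sum_add_distrib, Finset.sum_const,
    Finset.card_univ, Fintype.card_fin, nsmul_eq_mul, mul_one, card_mul_blockMean]
  have : 0 ≤ C' * T * d₀ := by positivity
  linarith

/-- The drift inequality for one step of the algorithm. -/
theorem exists_ghmcOp_cubicEnergy_le (LU LW m M γ : ℝ) (hLU : 0 ≤ LU) (hLW : 0 ≤ LW) (hm : 0 < m)
    (hM : 0 ≤ M) (hγ : 0 < γ) :
    ∃ θ₀ B c₁ : ℝ, 0 < θ₀ ∧ 0 < B ∧ 0 < c₁ ∧ θ₀ ≤ 1 ∧ c₁ * θ₀ ≤ 1 ∧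
      ∀ (d₀ q : ℕ) (Uq Wq : EuclideanSpace ℝ (Fin q) → ℝ), 1 ≤ q →
        PotentialAssumption Uq Wq LU LW m M →
      ∀ (ε δ T η : ℝ) (K : ℕ), 0 ≤ ε → ε ≤ θ₀ → 0 ≤ δ → 1 ≤ K → T = K * δ → T ≤ θ₀ →
        η = 1 - γ * T →
      ∀ z : BlockSpace d₀ q × BlockSpace d₀ q,
        ghmcOp (meanFieldPotential d₀ Uq Wq ε) K δ η
            (fun y => ENNReal.ofReal (cubicEnergy Uq γ (LU * (M / m)) y)) z ≤
          ENNReal.ofReal ((1 - c₁ * T) * cubicEnergy Uq γ (LU * (M / m)) z +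
            (1 - (1 - c₁ * T)) * (B * (d₀ * q ^ 3))) := by
  obtain ⟨θ₀, C, c₁, hθ₀, hC, hc₁, hθ1, hθγ, hθc, hstep⟩ :=
    exists_cubicEnergy_step LU LW m M γ hLU hLW hm hM hγ
  have h6 := sixthMoment_nonneg
  refine ⟨θ₀, C * (1 + sixthMoment) / c₁, c₁, hθ₀, by positivity, hc₁, hθ1, hθc, ?_⟩
  intro d₀ q Uq Wq hq h ε δ T η K hε hεθ hδ hK hT hTθ hη z
  have hT0 : 0 ≤ T := by rw [hT]; positivity
  have hγT : γ * T ≤ 1 := le_trans (by gcongr) hθγ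
  have hcT : c₁ * T ≤ 1 := le_trans (by gcongr) hθc
  have hη2 : 0 ≤ 1 - η ^ 2 := by
    have h1 : 0 ≤ γ * T := by positivity
    rw [hη]; nlinarith
  have hF : ∀ z : BlockSpace d₀ q × BlockSpace d₀ q, 0 ≤ cubicEnergy Uq γ (LU * (M / m)) z :=
    fun z => Finset.sum_nonneg fun i _ => pow_nonneg (blockEnergy_nonneg hm hM hγ h z i) 3
  have hst := hstep d₀ q Uq Wq h ε δ T η (Real.sqrt (1 - η ^ 2)) K hε hεθ hδ hK hT hTθ hη
    (Real.sqrt_nonneg _) (Real.sq_sqrt hη2) z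
  have hFz := hF z
  have hF' : 0 ≤ (1 - c₁ * T) * cubicEnergy Uq γ (LU * (M / m)) z :=
    mul_nonneg (by linarith) hFz
  rw [ghmcOp_apply]
  refine (lintegral_stdGaussian_le_of_add_neg_le (h := fun g => ENNReal.ofReal
    ((1 - c₁ * T) * cubicEnergy Uq γ (LU * (M / m)) z + C * T * d₀ + C * T * ∑ i, ‖g i‖ ^ 6))
    fun g => ?_).trans ?_
  · rw [← ENNReal.ofReal_add (hF _) (hF _)]
    refine (ENNReal.ofReal_le_ofReal (hst g)).trans_eq ?_
    rw [ENNReal.ofReal_mul (by norm_num), ENNReal.ofReal_ofNat]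
  · refine (lintegral_add_sum_norm_pow_six_le (by positivity) (by positivity)).trans
      (ENNReal.ofReal_le_ofReal ?_)
    have hq3 : (1 : ℝ) ≤ (q : ℝ) ^ 3 := one_le_pow₀ (by exact_mod_cast hq)
    have e1 : (1 - (1 - c₁ * T)) * (C * (1 + sixthMoment) / c₁ * (d₀ * q ^ 3)) =
        C * T * (d₀ * (q : ℝ) ^ 3) + C * T * (sixthMoment * (d₀ * q ^ 3)) := by
      field_simp; ring
    have e2 : C * T * d₀ ≤ C * T * (d₀ * (q : ℝ) ^ 3) := by
      gcongr; exact le_mul_of_one_le_right (by positivity) hq3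
    rw [e1]
    linarith

/-- The cubic energy is bounded by `𝔚`, whose terms of order six suffice for this. -/
theorem cubicEnergy_le_lyapunov {Uq Wq : EuclideanSpace ℝ (Fin q) → ℝ} {LU LW m M γ : ℝ}
    (hLU : 0 ≤ LU) (hm : 0 < m) (hM : 0 ≤ M) (hγ : 0 < γ)
    (h : PotentialAssumption Uq Wq LU LW m M) (z : BlockSpace d₀ q × BlockSpace d₀ q) :
    cubicEnergy Uq γ (LU * (M / m)) z ≤
      16 * (1 + LU + γ + γ ^ 2) ^ 3 * lyapunov z + 4 * (LU * (M / m)) ^ 3 * d₀ := by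
  have hc : 0 ≤ LU * (M / m) := by positivity
  have hi : ∀ i, blockEnergy Uq γ (LU * (M / m)) z i ^ 3 ≤
      16 * (1 + LU + γ + γ ^ 2) ^ 3 * (‖z.1 i‖ ^ 6 + ‖z.2 i‖ ^ 6) + 4 * (LU * (M / m)) ^ 3 :=
    fun i => by
      have h1 := pow_le_pow_left₀ (blockEnergy_nonneg hm hM hγ h z i)
        (blockEnergy_upper hLU hγ h z i) 3
      generalize LU * (M / m) = c at hc h1 ⊢
      have hA : 0 ≤ ‖z.1 i‖ ^ 2 + ‖z.2 i‖ ^ 2 := by positivity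
      have h2 := add_pow_le (a := (1 + LU + γ + γ ^ 2) * (‖z.1 i‖ ^ 2 + ‖z.2 i‖ ^ 2)) (b := c)
        (by positivity) hc 3
      have h3 := add_pow_le (sq_nonneg ‖z.1 i‖) (sq_nonneg ‖z.2 i‖) 3
      norm_num [← pow_mul] at h2 h3
      have h4 : (1 + LU + γ + γ ^ 2) ^ 3 * (‖z.1 i‖ ^ 2 + ‖z.2 i‖ ^ 2) ^ 3 ≤
          (1 + LU + γ + γ ^ 2) ^ 3 * (4 * (‖z.1 i‖ ^ 6 + ‖z.2 i‖ ^ 6)) := by gcongr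
      rw [mul_pow] at h2
      linarith
  have h6 : ∑ i, (‖z.1 i‖ ^ 6 + ‖z.2 i‖ ^ 6) ≤ lyapunov z := by
    unfold lyapunov
    exact Finset.single_le_sum (f := fun l => ∑ i, (‖z.1 i‖ ^ l + ‖z.2 i‖ ^ l))
      (fun l _ => by positivity) (by simp)
  calc cubicEnergy Uq γ (LU * (M / m)) z
      ≤ ∑ i, (16 * (1 + LU + γ + γ ^ 2) ^ 3 * (‖z.1 i‖ ^ 6 + ‖z.2 i‖ ^ 6) +
          4 * (LU * (M / m)) ^ 3) := Finset.sum_le_sum fun i _ => hi i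
    _ = 16 * (1 + LU + γ + γ ^ 2) ^ 3 * ∑ i, (‖z.1 i‖ ^ 6 + ‖z.2 i‖ ^ 6) +
          4 * (LU * (M / m)) ^ 3 * d₀ := by
        rw [Finset.sum_add_distrib, ← Finset.mul_sum, Finset.sum_const, Finset.card_univ,
          Fintype.card_fin, nsmul_eq_mul]
        ring
    _ ≤ _ := by gcongr

theorem lyapunov_le_sum_blockNorm (z : BlockSpace d₀ q × BlockSpace d₀ q) :
    lyapunov z ≤ 3 * ∑ i, blockNorm z i ^ 6 + 4 * d₀ := by
  have hi : ∀ i, (‖z.1 i‖ ^ 2 + ‖z.2 i‖ ^ 2) + (‖z.1 i‖ ^ 4 + ‖z.2 i‖ ^ 4) +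
      (‖z.1 i‖ ^ 6 + ‖z.2 i‖ ^ 6) ≤ 3 * blockNorm z i ^ 6 + 4 := fun i => by
    have hp : ∀ t : ℝ, 0 ≤ t → t ^ 2 + t ^ 4 + t ^ 6 ≤ 3 * t ^ 6 + 2 := fun t ht => by
      have e1 : t ^ 2 ≤ 1 + t ^ 6 := by
        nlinarith [sq_nonneg (t ^ 2 - 1), sq_nonneg t, mul_nonneg (sq_nonneg t)
          (sq_nonneg (t ^ 2 - 1))]
      have e2 : t ^ 4 ≤ 1 + t ^ 6 := by
        nlinarith [sq_nonneg (t ^ 2 - 1), sq_nonneg t, mul_nonneg (sq_nonneg t)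
          (sq_nonneg (t ^ 2 - 1))]
      linarith
    have h1 : ‖z.1 i‖ ^ 6 + ‖z.2 i‖ ^ 6 ≤ blockNorm z i ^ 6 :=
      pow_add_pow_le (norm_nonneg _) (norm_nonneg _) (by norm_num)
    linarith [hp ‖z.1 i‖ (norm_nonneg _), hp ‖z.2 i‖ (norm_nonneg _)]
  have h1 : lyapunov z = ∑ i, ((‖z.1 i‖ ^ 2 + ‖z.2 i‖ ^ 2) + (‖z.1 i‖ ^ 4 + ‖z.2 i‖ ^ 4) +
      (‖z.1 i‖ ^ 6 + ‖z.2 i‖ ^ 6)) := by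
    unfold lyapunov
    rw [Finset.sum_insert (by simp), Finset.sum_insert (by simp), Finset.sum_singleton]
    simp only [Finset.sum_add_distrib]
    ring
  rw [h1]
  refine (Finset.sum_le_sum fun i _ => hi i).trans_eq ?_
  rw [Finset.sum_add_distrib, ← Finset.mul_sum, Finset.sum_const, Finset.card_univ,
    Fintype.card_fin, nsmul_eq_mul]
  ring

theorem sum_blockNorm_pow_le {Uq Wq : EuclideanSpace ℝ (Fin q) → ℝ} {LU LW m M γ : ℝ}
    (hm : 0 < m) (hM : 0 ≤ M) (hγ : 0 < γ) (h : PotentialAssumption Uq Wq LU LW m M)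
    (z : BlockSpace d₀ q × BlockSpace d₀ q) :
    ∑ i, blockNorm z i ^ 6 ≤
      8 / min (1 / 8) (γ ^ 2 / 12) ^ 3 * cubicEnergy Uq γ (LU * (M / m)) z := by
  have hlow := blockEnergy_lower hm hM hγ h z
  have hc₀ : 0 < min (1 / 8) (γ ^ 2 / 12) := by positivity
  generalize min (1 / 8) (γ ^ 2 / 12) = c₀ at hlow hc₀ ⊢
  rw [cubicEnergy, Finset.mul_sum]
  refine Finset.sum_le_sum fun i _ => ?_
  have h1 : blockNorm z i ^ 2 ≤ 2 * (‖z.1 i‖ ^ 2 + ‖z.2 i‖ ^ 2) := add_sq_le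
  have h2 : blockNorm z i ^ 2 ≤ 2 / c₀ * blockEnergy Uq γ (LU * (M / m)) z i := by
    refine h1.trans ?_
    rw [div_mul_eq_mul_div, le_div_iff₀ hc₀]
    linarith [hlow i]
  calc blockNorm z i ^ 6 = (blockNorm z i ^ 2) ^ 3 := by ring
    _ ≤ (2 / c₀ * blockEnergy Uq γ (LU * (M / m)) z i) ^ 3 := by gcongr
    _ = _ := by ring

/-- Grönwall bound for the sixth powers of the block sizes along a trajectory of length at most
one. -/
theorem sum_blockNorm_verlet_iterate_le {Uq Wq : EuclideanSpace ℝ (Fin q) → ℝ}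
    {LU LW m M ε δ Λ : ℝ} (hLU : 0 ≤ LU) (hLW : 0 ≤ LW) (h : PotentialAssumption Uq Wq LU LW m M)
    (hε : 0 ≤ ε) (hε1 : ε ≤ 1) (hδ : 0 ≤ δ) (hδ1 : δ ≤ 1) {k : ℕ} (hk : k * δ ≤ 1)
    (hΛ : Λ = 1 + LU + 2 * LW) (y : BlockSpace d₀ q × BlockSpace d₀ q) :
    ∑ i, blockNorm ((verlet (meanFieldPotential d₀ Uq Wq ε) δ)^[k] y) i ^ 6 ≤
      64 * Real.exp (18 * Λ ^ 2) ^ 6 * ∑ i, blockNorm y i ^ 6 := by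
  rcases Nat.eq_zero_or_pos d₀ with hd | hd
  · subst hd; simp
  have : NeZero d₀ := ⟨hd.ne'⟩
  have hκΛ : LU + 2 * LW * ε ≤ Λ := by
    have : 2 * LW * ε ≤ 2 * LW := mul_le_of_le_one_right (by positivity) hε1
    rw [hΛ]; linarith
  have hi : ∀ i, blockNorm ((verlet (meanFieldPotential d₀ Uq Wq ε) δ)^[k] y) i ^ 6 ≤
      Real.exp (18 * Λ ^ 2) ^ 6 *
        (32 * (blockNorm y i ^ 6 + blockMean fun j => blockNorm y j ^ 6)) := fun i => by
    have h1 := (blockNorm_le_totalNorm _ i).trans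
      (totalNorm_verlet_iterate_le (nearlyDecoupled_gradient (d₀ := d₀) h hε) hLU (by positivity)
        hκΛ (by rw [hΛ]; linarith) hδ hδ1 y i k hk)
    have h2 := pow_le_pow_left₀ (blockNorm_nonneg _ _) h1 6
    rw [mul_pow] at h2
    refine h2.trans ?_
    gcongr
    have hm : 0 ≤ blockMean (blockNorm y) := blockMean_nonneg (blockNorm_nonneg y)
    have h3 := add_pow_six_le (blockNorm_nonneg y i) hm
    have h4 := blockMean_pow_le (blockNorm_nonneg y) 6
    unfold totalNorm
    linarith
  refine (Finset.sum_le_sum fun i _ => hi i).trans_eq ?_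
  simp only [← Finset.mul_sum, Finset.sum_add_distrib, Finset.sum_const, Finset.card_univ,
    Fintype.card_fin, nsmul_eq_mul, card_mul_blockMean]
  ring

end Lyapunov

/-! ### From the cubic energy back to `𝔚` -/

/-- The part `D_η V_δ^k` of a step that precedes the iterations, applied to the original
Lyapunov function. -/
theorem exists_refreshOp_verletOp_lyapunov_le (LU LW m M γ : ℝ) (hLU : 0 ≤ LU) (hLW : 0 ≤ LW)
    (hm : 0 < m) (hM : 0 ≤ M) (hγ : 0 < γ) :
    ∃ A : ℝ, 0 < A ∧
      ∀ (d₀ q : ℕ) (Uq Wq : EuclideanSpace ℝ (Fin q) → ℝ), 1 ≤ q →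
        PotentialAssumption Uq Wq LU LW m M →
      ∀ (ε δ η : ℝ) (k : ℕ), 0 ≤ ε → ε ≤ 1 → 0 ≤ δ → δ ≤ 1 → k * δ ≤ 1 → 0 ≤ η → η ≤ 1 →
      ∀ z : BlockSpace d₀ q × BlockSpace d₀ q,
        refreshOp η ((verletOp (meanFieldPotential d₀ Uq Wq ε) δ)^[k]
            (fun y => ENNReal.ofReal (lyapunov y))) z ≤
          ENNReal.ofReal (A * cubicEnergy Uq γ (LU * (M / m)) z + A * (d₀ * q ^ 3)) := by
  have h6 := sixthMoment_nonneg
  obtain ⟨Λ, hΛ⟩ : ∃ x, x = 1 + LU + 2 * LW := ⟨_, rfl⟩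
  obtain ⟨a, ha⟩ : ∃ x, x = 3 * (64 * Real.exp (18 * Λ ^ 2) ^ 6) * 32 := ⟨_, rfl⟩
  have ha0 : 0 < a := by rw [ha]; positivity
  obtain ⟨b, hb⟩ : ∃ x, x = 8 / min (1 / 8) (γ ^ 2 / 12) ^ 3 := ⟨_, rfl⟩
  have hb0 : 0 < b := by rw [hb]; positivity
  refine ⟨a * b + 4 + a * sixthMoment, by positivity, ?_⟩
  intro d₀ q Uq Wq hq h ε δ η k hε hε1 hδ hδ1 hk hη hη1 z
  have hFz : 0 ≤ cubicEnergy Uq γ (LU * (M / m)) z :=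
    Finset.sum_nonneg fun i _ => pow_nonneg (blockEnergy_nonneg hm hM hγ h z i) 3
  have hpt : ∀ g : BlockSpace d₀ q,
      lyapunov ((verlet (meanFieldPotential d₀ Uq Wq ε) δ)^[k]
        (refresh η (Real.sqrt (1 - η ^ 2)) z g)) ≤
      (a * b * cubicEnergy Uq γ (LU * (M / m)) z + 4 * d₀) + a * ∑ i, ‖g i‖ ^ 6 := fun g => by
    have hσ1 : Real.sqrt (1 - η ^ 2) ≤ 1 := by
      exact Real.sqrt_le_iff.2 ⟨zero_le_one, by linarith [sq_nonneg η]⟩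
    have h1 := lyapunov_le_sum_blockNorm ((verlet (meanFieldPotential d₀ Uq Wq ε) δ)^[k]
        (refresh η (Real.sqrt (1 - η ^ 2)) z g))
    have h2 := sum_blockNorm_verlet_iterate_le hLU hLW h hε hε1 hδ hδ1 hk hΛ
      (refresh η (Real.sqrt (1 - η ^ 2)) z g)
    have h3 : ∑ i, blockNorm (refresh η (Real.sqrt (1 - η ^ 2)) z g) i ^ 6 ≤
        32 * (∑ i, blockNorm z i ^ 6 + ∑ i, ‖g i‖ ^ 6) := by
      rw [← Finset.sum_add_distrib, Finset.mul_sum]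
      refine Finset.sum_le_sum fun i _ => ?_
      exact (pow_le_pow_left₀ (blockNorm_nonneg _ _)
        (blockNorm_refresh_le hη hη1 (Real.sqrt_nonneg _) hσ1 z g i) 6).trans
        (add_pow_six_le (blockNorm_nonneg z i) (norm_nonneg _))
    have h4 := sum_blockNorm_pow_le hm hM hγ h z
    rw [← hb] at h4
    calc _ ≤ 3 * (64 * Real.exp (18 * Λ ^ 2) ^ 6 *
          (32 * (b * cubicEnergy Uq γ (LU * (M / m)) z + ∑ i, ‖g i‖ ^ 6))) + 4 * d₀ := by
          refine h1.trans ?_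
          gcongr
          refine h2.trans ?_
          gcongr
          refine h3.trans ?_
          gcongr
      _ = _ := by rw [ha]; ring
  rw [iterate_verletOp]
  refine (lintegral_mono fun g => ENNReal.ofReal_le_ofReal (hpt g)).trans ?_
  refine (lintegral_add_sum_norm_pow_six_le (by positivity) ha0.le).trans
    (ENNReal.ofReal_le_ofReal ?_)
  have hq3 : (1 : ℝ) ≤ (q : ℝ) ^ 3 := one_le_pow₀ (by exact_mod_cast hq)
  have e1 : (d₀ : ℝ) ≤ d₀ * (q : ℝ) ^ 3 := le_mul_of_one_le_right (by positivity) hq3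
  have e2 : 0 ≤ (4 + a * sixthMoment) * cubicEnergy Uq γ (LU * (M / m)) z := by positivity
  have e3 : 0 ≤ a * b * (d₀ * (q : ℝ) ^ 3) := by positivity
  linarith

end GHMC

theorem theorem3 (LU LW m M γ₀ : ℝ) (hLU : 0 ≤ LU) (hLW : 0 ≤ LW) (hm : 0 < m) (hM : 0 ≤ M)
    (hγ₀ : 0 < γ₀) :
    ∃ Tbar δbar C₁ C₂ εbar ρ : ℝ,
      0 < Tbar ∧ 0 < δbar ∧ 0 < C₁ ∧ 0 < C₂ ∧ 0 < εbar ∧ 0 < ρ ∧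
      ∀ (d₀ q : ℕ), 1 ≤ d₀ → 1 ≤ q →
      ∀ (Uq Wq : EuclideanSpace ℝ (Fin q) → ℝ), GHMC.PotentialAssumption Uq Wq LU LW m M →
      ∀ (ε : ℝ), 0 < ε → ε ≤ εbar →
      ∀ (K : ℕ) (δ η : ℝ), 1 ≤ K → 0 < δ → δ ≤ δbar → 0 ≤ η → η < 1 →
        (1 - η) / (K * δ) = γ₀ → K * δ ≤ Tbar →
      ∀ (z : GHMC.BlockSpace d₀ q × GHMC.BlockSpace d₀ q) (k n : ℕ), k ≤ K →
        (GHMC.ghmcOp (GHMC.meanFieldPotential d₀ Uq Wq ε) K δ η)^[n]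
            (GHMC.refreshOp η
              ((GHMC.verletOp (GHMC.meanFieldPotential d₀ Uq Wq ε) δ)^[k]
                (fun y => ENNReal.ofReal (GHMC.lyapunov y)))) z
          ≤ ENNReal.ofReal
              (C₁ * Real.exp (-ρ * n * (K * δ)) * GHMC.lyapunov z + C₂ * d₀ * (q : ℝ) ^ 3) := by
  obtain ⟨θ₀, B, ρ, hθ₀, hB, hρ, hθ1, hθρ, hdrift⟩ :=
    GHMC.exists_ghmcOp_cubicEnergy_le LU LW m M γ₀ hLU hLW hm hM hγ₀
  obtain ⟨A, hA, hcrude⟩ :=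
    GHMC.exists_refreshOp_verletOp_lyapunov_le LU LW m M γ₀ hLU hLW hm hM hγ₀
  refine ⟨θ₀, 1, A * (16 * (1 + LU + γ₀ + γ₀ ^ 2) ^ 3), A * (4 * (LU * (M / m)) ^ 3) + A * B + A,
    θ₀, ρ, hθ₀, one_pos, by positivity, by positivity, hθ₀, hρ, ?_⟩
  intro d₀ q _ hq Uq Wq h ε hε hεθ K δ η hK hδ hδ1 hη hη1 hγ hT z k n hk
  have hK0 : (0 : ℝ) < K := by exact_mod_cast hK
  have hT0 : 0 < K * δ := by positivity
  have hη' : η = 1 - γ₀ * (K * δ) := by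
    rw [div_eq_iff hT0.ne'] at hγ; linarith
  have hkδ : k * δ ≤ 1 := by
    have : (k : ℝ) * δ ≤ K * δ := by gcongr
    linarith
  have hcr := hcrude d₀ q Uq Wq hq h ε δ η k hε.le (hεθ.trans hθ1) hδ.le hδ1 hkδ hη hη1.le
  have hdr := hdrift d₀ q Uq Wq hq h ε δ (K * δ) η K hε.le hεθ hδ.le hK rfl hT hη'
  have hFl := GHMC.cubicEnergy_le_lyapunov hLU hm hM hγ₀ h z
  have hF : ∀ z : GHMC.BlockSpace d₀ q × GHMC.BlockSpace d₀ q,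
      0 ≤ GHMC.cubicEnergy Uq γ₀ (LU * (M / m)) z := fun z =>
    Finset.sum_nonneg fun i _ => pow_nonneg (GHMC.blockEnergy_nonneg hm hM hγ₀ h z i) 3
  have hρT : ρ * (K * δ) ≤ 1 := le_trans (by gcongr) hθρ
  have hρT0 : 0 ≤ ρ * (K * δ) := by positivity
  refine ((GHMC.ghmcOp_mono _ K δ η).iterate n hcr z).trans ?_
  refine (GHMC.iterate_ghmcOp_le _ K δ η _ (by linarith) (by linarith) (by positivity) hF hdr n
    hA.le (by positivity) z).trans (ENNReal.ofReal_le_ofReal ?_)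
  have hl0 : 0 ≤ (1 - ρ * (K * δ)) ^ n := pow_nonneg (by linarith) n
  have hl1 : (1 - ρ * (K * δ)) ^ n ≤ 1 := pow_le_one₀ (by linarith) (by linarith)
  have hexp : (1 - ρ * (K * δ)) ^ n ≤ Real.exp (-ρ * n * (K * δ)) := by
    calc (1 - ρ * (K * δ)) ^ n ≤ Real.exp (-(ρ * (K * δ))) ^ n := by
          refine pow_le_pow_left₀ (by linarith) ?_ n
          linarith [Real.add_one_le_exp (-(ρ * (K * δ)))]
      _ = _ := by rw [← Real.exp_nat_mul]; ring_nf
  generalize (1 - ρ * (K * δ)) ^ n = l at hl0 hl1 hexp ⊢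
  have hlyap : 0 ≤ GHMC.lyapunov z := by unfold GHMC.lyapunov; positivity
  have hq3 : (1 : ℝ) ≤ (q : ℝ) ^ 3 := one_le_pow₀ (by exact_mod_cast hq)
  have hd : (d₀ : ℝ) ≤ d₀ * (q : ℝ) ^ 3 := le_mul_of_one_le_right (by positivity) hq3
  have hc0 : 0 ≤ LU * (M / m) := by positivity
  have e1 : A * l * GHMC.cubicEnergy Uq γ₀ (LU * (M / m)) z ≤
      A * l * (16 * (1 + LU + γ₀ + γ₀ ^ 2) ^ 3 * GHMC.lyapunov z) +
        A * l * (4 * (LU * (M / m)) ^ 3 * d₀) := by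
    rw [← mul_add]; gcongr
  have e2 : A * l * (16 * (1 + LU + γ₀ + γ₀ ^ 2) ^ 3 * GHMC.lyapunov z) ≤
      A * Real.exp (-ρ * n * (K * δ)) *
        (16 * (1 + LU + γ₀ + γ₀ ^ 2) ^ 3 * GHMC.lyapunov z) := by gcongr
  have e3 : A * l * (4 * (LU * (M / m)) ^ 3 * d₀) ≤
      A * 1 * (4 * (LU * (M / m)) ^ 3 * (d₀ * (q : ℝ) ^ 3)) := by gcongr
  have e4 : A * (B * (d₀ * (q : ℝ) ^ 3)) * (1 - l) ≤ A * (B * (d₀ * (q : ℝ) ^ 3)) * 1 := by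
    gcongr; linarith
  linarith
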